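/- Let $0\le k\le n$ be integers with $n\ge 1$. **Symmetric group.** Permutations in $S_n$ are composed from right to left, $\ell$ is the number of inversions, $\le$ is the Bruhat order, and $[u,w]=\{v\in S_n : u\le v\le w\}$. The $k$-Bruhat order $\le_k$ on $S_n$ is the reflexive transitive closure of those Bruhat covers $u\lessdot w$ for which $u(\{1,\dots,k\})\ne w(\{1,\dots,k\})$. For $u\le_k w$ let $[u,w]_k$ be the $k$-Bruhat interval. Let $\sim$ be the equivalence relation on $k$-Bruhat intervals generated by $[u,w]_k\sim[uz,wz]_k$, where $z\in S_k\times S_{n-k}$, $\ell(uz)=\ell(u)+\ell(z)$ and $\ell(wz)=\ell(w)+\ell(z)$ (and both $[u,w]_k$ and $[uz,wz]_k$ are $k$-Bruhat intervals). Let $\langle u,w\rangle$ be the class of $[u,w]_k$ and $\mathcal Q(k,n)$ the set of classes. Put $q\le q'$ in $\mathcal Q(k,n)$ if there are representatives $[u,w]_k$ of $q$ and $[u',w']_k$ of $q'$ with $[u',w']\subseteq[u,w]$ (reverse containment of Bruhat intervals). **Affine permutations.** Let $\tilde S_n$ be the group of bijections $f:\mathbb Z\to\mathbb Z$ with $f(i+n)=f(i)+n$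 for all $i$. Let $\tilde S_n^k$ be the set of $f\in\tilde S_n$ with $\frac1n\sum_{i=1}^n(f(i)-i)=k$, with the affine Bruhat order, i.e. the reflexive transitive closure of $f<ft$ for $t$ an affine reflection (exchanging $i+rn$ and $j+rn$ for all $r\in\mathbb Z$, where $i\not\equiv j \bmod n$, and fixing all other integers) with $\ell(f)<\ell(ft)$. Here $\ell(f)$ is the number of pairs $i<j$ of integers with $f(i)>f(j)$, counted modulo simultaneous translation of $(i,j)$ by multiples of $n$. Let $\mathrm{Bound}(k,n)$ be the set of $f\in\tilde S_n^k$ with $i\le f(i)\le i+n$ for all $i$, with the restricted order. Regard $S_n\subset\tilde S_n$ by periodic extension, and let $t_{\omega_k}\in\tilde S_n$ be given by $t_{\omega_k}(i)=i+n$ for $1\le i\le k$ and $t_{\omega_k}(i)=i$ for $k<i\le n$. **Theorem.** The map $\langle u,w\rangle\mapsto f_{u,w}=u\,t_{\omega_k}w^{-1}$ is well defined and is an isomorphism of posets from $(\mathcal Q(k,n),\le)$ onto $(\mathrm{Bound}(k,n),\le)$; in particular both relations are partial orders. For every $u\le_k w$, $$\ell(f_{u,w})=k(n-k)-\ell(w)+\ell(u).$$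 Moreover $\mathrm{Bound}(k,n)$ is a lower order ideal in $\tilde S_n^k$ for the affine Bruhat order: if $f\in\mathrm{Bound}(k,n)$, $g\in\tilde S_n^k$ and $g\le f$, then $g\in\mathrm{Bound}(k,n)$. -/

import Mathlib

/-! Permutations of `[n]` are modelled by `Equiv.Perm (Fin n)`; the element `a : Fin n` stands
for `a + 1 ∈ [n]`.  Products are composed from right to left. -/

namespace BoundedAffine

/-! ### The symmetric group -/

/-- The length of `w`: the number of its inversions. -/
def permLength {n : ℕ} (w : Equiv.Perm (Fin n)) : ℕ :=
  (Finset.univ.filter fun p : Fin n × Fin n => p.1 < p.2 ∧ w p.2 < w p.1).card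

/-- The (strong) Bruhat order on the Coxeter group `S_n`: the reflexive transitive closure of
`u < u t`, where `t` is a reflection (transposition) and `u t` is longer than `u`. -/
def BruhatLE {n : ℕ} : Equiv.Perm (Fin n) → Equiv.Perm (Fin n) → Prop :=
  Relation.ReflTransGen fun u v =>
    ∃ t : Equiv.Perm (Fin n), t.IsSwap ∧ v = u * t ∧ permLength u < permLength v

/-- `w` covers `u` in Bruhat order. -/
def BruhatCovers {n : ℕ} (u w : Equiv.Perm (Fin n)) : Prop :=
  BruhatLE u w ∧ u ≠ w ∧ ∀ v, BruhatLE u v → BruhatLE v w → v = u ∨ v = w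

/-- The set `σ_k(w) = w([k])`. -/
def sigma (k : ℕ) {n : ℕ} (w : Equiv.Perm (Fin n)) : Finset (Fin n) :=
  (Finset.univ.filter fun a : Fin n => a.val < k).image w

/-- The `k`-Bruhat order `u ≤_k w`: generated by those Bruhat covers that change `σ_k`. -/
def KBruhatLE (k : ℕ) {n : ℕ} : Equiv.Perm (Fin n) → Equiv.Perm (Fin n) → Prop :=
  Relation.ReflTransGen fun u w => BruhatCovers u w ∧ sigma k u ≠ sigma k w

/-- Membership in the parabolic subgroup `S_k × S_{n-k}` of `S_n`. -/
def InParabolic (k : ℕ) {n : ℕ} (z : Equiv.Perm (Fin n)) : Prop :=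
  ∀ a : Fin n, (z a).val < k ↔ a.val < k

/-! ### The poset `Q(k,n)` -/

/-- A `k`-Bruhat interval `[u,w]_k`, given by its end points `u ≤_k w`. -/
structure KInterval (k n : ℕ) where
  /-- the lower end point -/
  u : Equiv.Perm (Fin n)
  /-- the upper end point -/
  w : Equiv.Perm (Fin n)
  le : KBruhatLE k u w

/-- The generating relations for equivalence of `k`-Bruhat intervals: `u z = x`, `w z = y` are
length-additive factorizations with a common `z ∈ S_k × S_{n-k}`. -/
def IntervalStep (k n : ℕ) (I J : KInterval k n) : Prop :=
  ∃ z : Equiv.Perm (Fin n), InParabolic k z ∧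
    (J.u = I.u * z ∧ permLength J.u = permLength I.u + permLength z) ∧
    (J.w = I.w * z ∧ permLength J.w = permLength I.w + permLength z)

/-- The set `Q(k,n)` of classes of `k`-Bruhat intervals under the equivalence relation generated
by `IntervalStep` (`Quot` is the quotient by the generated equivalence relation). -/
def Q (k n : ℕ) : Type := Quot (IntervalStep k n)

/-- The class `⟨u,w⟩` of `[u,w]_k`. -/
def KInterval.cls {k n : ℕ} (I : KInterval k n) : Q k n := Quot.mk _ I

/-- The interval `[u,w]` in the Bruhat order of `S_n`. -/
def bruhatInterval {n : ℕ} (u w : Equiv.Perm (Fin n)) : Set (Equiv.Perm (Fin n)) :=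
  {v | BruhatLE u v ∧ BruhatLE v w}

/-- The order on `Q(k,n)`: `q ≤ q'` if there are representatives `[u,w]_k` of `q` and
`[u',w']_k` of `q'` with `[u',w'] ⊆ [u,w]` (reverse containment of Bruhat intervals, so that
larger intervals are smaller elements and `k(n-k) - (ℓ(w) - ℓ(u))` is the rank function). -/
def QLE (k n : ℕ) (q q' : Q k n) : Prop :=
  ∃ I J : KInterval k n, I.cls = q ∧ J.cls = q' ∧
    bruhatInterval J.u J.w ⊆ bruhatInterval I.u I.w

/-! ### Affine permutations -/

/-- The group of affine permutations: bijections `f : ℤ → ℤ` with `f (i + n) = f i + n`. -/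
def AffinePerm (n : ℕ) : Subgroup (Equiv.Perm ℤ) where
  carrier := {f | ∀ i : ℤ, f (i + n) = f i + n}
  mul_mem' := by
    intro f g hf hg i
    change f (g (i + n)) = f (g i) + n
    rw [hg i, hf]
  one_mem' := fun _ => rfl
  inv_mem' := by
    intro f hf i
    apply f.injective
    rw [hf]
    simp

/-- The ball number `(1/n) ∑_{i=1}^n (f(i) - i)`. -/
noncomputable def ballNumber {n : ℕ} (f : AffinePerm n) : ℚ :=
  (1 / (n : ℚ)) * ∑ i ∈ Finset.Icc (1 : ℤ) n, ((f.1 i - i : ℤ) : ℚ)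

/-- The affine permutations with ball number `k`. -/
def AffinePermOfBall (k n : ℕ) : Set (AffinePerm n) := {f | ballNumber f = k}

/-- The inversions of `f`: pairs `i < j` of integers with `f i > f j`. -/
def AffineInversion {n : ℕ} (f : AffinePerm n) : Type :=
  {p : ℤ × ℤ // p.1 < p.2 ∧ f.1 p.2 < f.1 p.1}

/-- Two inversions are equivalent if they differ by a simultaneous shift by a multiple of `n`. -/
def affineInversionSetoid {n : ℕ} (f : AffinePerm n) : Setoid (AffineInversion f) where
  r p q := ∃ r : ℤ, q.1.1 = p.1.1 + r * n ∧ q.1.2 = p.1.2 + r * n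
  iseqv :=
    { refl := fun _ => ⟨0, by simp, by simp⟩
      symm := by
        rintro p q ⟨r, h1, h2⟩
        exact ⟨-r, by rw [h1]; ring, by rw [h2]; ring⟩
      trans := by
        rintro p q s ⟨r, h1, h2⟩ ⟨r', h3, h4⟩
        exact ⟨r + r', by rw [h3, h1]; ring, by rw [h4, h2]; ring⟩ }

/-- The length of an affine permutation: the number of equivalence classes of inversions. -/
noncomputable def affineLength {n : ℕ} (f : AffinePerm n) : ℕ :=
  Nat.card (Quotient (affineInversionSetoid f))

/-- The reflections of the affine symmetric group: for some `i ≢ j` modulo `n`, exchange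
`i + r n` and `j + r n` for all integers `r`, and fix all other integers. -/
def IsAffineReflection {n : ℕ} (t : AffinePerm n) : Prop :=
  ∃ i j : ℤ, ¬ i ≡ j [ZMOD n] ∧
    (∀ r : ℤ, t.1 (i + r * n) = j + r * n ∧ t.1 (j + r * n) = i + r * n) ∧
    ∀ m : ℤ, ¬ m ≡ i [ZMOD n] → ¬ m ≡ j [ZMOD n] → t.1 m = m

/-- The affine Bruhat order: the reflexive transitive closure of `f < f t`, where `t` is a
reflection and `f t` is longer than `f`.  Reflections have ball number `0`, so comparable
elements have the same ball number.  On ball number `0` this is the Bruhat order of the Coxeter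
group; composing on the right with a shift of `ℤ` preserves lengths and permutes the
reflections, so on ball number `k` it is the order transported from ball number `0`. -/
def AffineBruhatLE {n : ℕ} : AffinePerm n → AffinePerm n → Prop :=
  Relation.ReflTransGen fun f g =>
    ∃ t : AffinePerm n, IsAffineReflection t ∧ g = f * t ∧ affineLength f < affineLength g

/-- The set `Bound(k,n)` of bounded affine permutations. -/
def Bound (k n : ℕ) : Set (AffinePerm n) :=
  {f | f ∈ AffinePermOfBall k n ∧ ∀ i : ℤ, i ≤ f.1 i ∧ f.1 i ≤ i + n}

/-- The restriction of the affine Bruhat order to `Bound(k,n)`. -/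
def BoundLE (k n : ℕ) (f g : Bound k n) : Prop := AffineBruhatLE f.1 g.1

/-! ### The map `⟨u,w⟩ ↦ f_{u,w}` -/

/-- The decomposition `i = q n + (a + 1)` of an integer `i`, with `a : Fin n`. -/
def window (n : ℕ) [NeZero n] : ℤ ≃ ℤ × Fin n :=
  (Equiv.subRight (1 : ℤ)).trans (Int.divModEquiv n)

/-- Adding `n` increases the quotient by one. -/
theorem window_add (n : ℕ) [NeZero n] (i : ℤ) :
    window n (i + n) = ((window n i).1 + 1, (window n i).2) := by
  have hn : (n : ℤ) ≠ 0 := by exact_mod_cast NeZero.ne n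
  have h : i + n - 1 = (i - 1) + n := by ring
  simp only [window, Equiv.trans_apply, Equiv.subRight_apply, Int.divModEquiv, Equiv.coe_fn_mk, h]
  ext
  · simp [Int.add_ediv_of_dvd_right (dvd_refl (n : ℤ)), Int.ediv_self hn]
  · simp [Int.natMod]

/-- Adding one to the quotient adds `n`. -/
theorem window_symm_add (n : ℕ) [NeZero n] (q : ℤ) (a : Fin n) :
    (window n).symm (q + 1, a) = (window n).symm (q, a) + n := by
  rw [Equiv.symm_apply_eq, window_add]
  simp

/-- The periodic extension to `ℤ` of a permutation of `[n]`. -/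
def extendPerm {n : ℕ} [NeZero n] (π : Equiv.Perm (Fin n)) : AffinePerm n :=
  ⟨((window n).trans (Equiv.prodCongr (Equiv.refl ℤ) π)).trans (window n).symm, by
    intro i
    simp only [Equiv.trans_apply, window_add]
    exact window_symm_add n _ _⟩

/-- The translation element `t_μ`, with `t_μ(i) = n μ_i + i` for `1 ≤ i ≤ n`. -/
def translation {n : ℕ} [NeZero n] (μ : Fin n → ℤ) : AffinePerm n :=
  ⟨{ toFun := fun i => n * μ (window n i).2 + i
     invFun := fun i => i - n * μ (window n i).2
     left_inv := by
      intro i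
      have key : ∀ (m i : ℤ), (window n (n * m + i)).2 = (window n i).2 := by
        intro m i
        induction m using Int.induction_on with
        | zero => simp
        | succ m ih =>
          rw [← ih, show (n : ℤ) * (m + 1) + i = (n * m + i) + n by ring, window_add]
        | pred m ih =>
          rw [← ih, show (n : ℤ) * (-m) + i = (n * (-m - 1) + i) + n by ring, window_add]
      simp only [key]
      ring
     right_inv := by
      intro i
      have key : ∀ (m i : ℤ), (window n (i - n * m)).2 = (window n i).2 := by
        intro m i
        induction m using Int.induction_on with
        | zero => simp
        | succ m ih =>
          rw [← ih, show i - (n : ℤ) * m = (i - n * (m + 1)) + n by ring, window_add]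
        | pred m ih =>
          rw [← ih, show i - (n : ℤ) * (-m - 1) = (i - n * (-m)) + n by ring, window_add]
      simp only [key]
      ring }, by
    intro i
    change n * μ (window n (i + n)).2 + (i + n) = n * μ (window n i).2 + i + n
    rw [window_add]
    ring⟩

/-- The fundamental weight `ω_k = (1,…,1,0,…,0)` with `k` ones. -/
def omega (k n : ℕ) : Fin n → ℤ := fun a => if a.val < k then 1 else 0

/-- The affine permutation `f_{u,w} = u t_{ω_k} w⁻¹`. -/
def fuw (k : ℕ) {n : ℕ} [NeZero n] (u w : Equiv.Perm (Fin n)) : AffinePerm n :=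
  extendPerm u * translation (omega k n) * (extendPerm w)⁻¹

end BoundedAffine

/-! Everything is governed by a length formula valid for arbitrary $u,w\in S_n$:
$\ell(f_{u,w})+\ell(w)=k(n-k)+\ell(u)+2d(u,w)$, where the defect $d$ (`blockDefect`) counts pairs of
positions in one block $\{1,\dots,k\}$ or $\{k+1,\dots,n\}$ that are inverted by $w$ but not by $u$.
The relation $u\le_k w$ is replaced by the Bergeron–Sottile criterion `KCriterion`, which says
exactly that $f_{u,w}$ is bounded and $d(u,w)=0$. This gives the length formula of the theorem. It
also gives a recurring parity-and-length argument: if a transposition changes $\ell(f_{u,w})$ by one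
and moves the length of $u$ or $w$ in the right direction, the formula forces the new defect to
vanish, so the criterion persists.

Bijectivity: right multiplication of both end points by $z\in S_k\times S_{n-k}$ does not change
$f_{u,w}$, and every class contains an interval whose upper end point is increasing on both blocks.
Such a $w$ is recovered from $f$, because $w(\{1,\dots,k\})$ is the set of $c\in[n]$ with $f(c)>n$;
a bounded $f$ has exactly $k$ of these.

Order: the rank numbers `lowCount`, counting positions $p\ge r$ with $f(p)\le q$, increase along the
Bruhat order. Conversely, if the ranks of $f\ne g$ are comparable, some transposition raises $f$ by
one in length while keeping it bounded and its ranks below those of $g$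
(`exists_cover_of_lowCount_le`). Each such cover shrinks a given interval at one end
(`KCriterion.exists_of_cover`), so a Bruhat relation yields nested intervals. For the other
direction, nested Bruhat intervals are carried by the lifting property to a larger interval with
Grassmannian top, where nesting can be read off as an inequality of the ranks of $f$
(`Grassmannian.lowCount_le`). Thus Bruhat order, rank order and nesting coincide.

The order ideal property is elementary: undoing an inversion $i<j$ of a bounded $g$ puts at $i$ and
$j$ values between $j$ and $i+n$. -/

namespace BoundedAffine

set_option linter.unusedSectionVars false

/-! ### Affine permutations and affine transpositions -/

theorem affine_apply_add_mul {n : ℕ} (f : AffinePerm n) (i m : ℤ) :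
    f.1 (i + m * n) = f.1 i + m * n := by
  have h : ∀ i : ℤ, f.1 (i + n) = f.1 i + n := f.2
  induction m using Int.induction_on with
  | zero => simp
  | succ m ih =>
    rw [show i + ((m : ℤ) + 1) * n = (i + m * n) + n by ring, h, ih]; ring
  | pred m ih =>
    have := h (i + (-(m : ℤ) - 1) * n)
    rw [show i + (-(m : ℤ) - 1) * n + n = i + (-(m : ℤ)) * n by ring, ih] at this
    linarith

theorem dvd_affine_apply_sub_iff {n : ℕ} (f : AffinePerm n) (i j : ℤ) :
    (n : ℤ) ∣ f.1 i - f.1 j ↔ (n : ℤ) ∣ i - j := by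
  constructor
  · rintro ⟨c, hc⟩
    have : f.1 i = f.1 (j + c * n) := by rw [affine_apply_add_mul f]; linarith
    have := f.1.injective this
    exact ⟨c, by linarith⟩
  · rintro ⟨c, hc⟩
    have : i = j + c * n := by linarith
    rw [this, affine_apply_add_mul f]
    exact ⟨c, by ring⟩

/-- The map exchanging `i + r n` and `j + r n` for all `r`. -/
def affineSwapFun (n : ℕ) (i j m : ℤ) : ℤ :=
  if (n : ℤ) ∣ m - i then m + (j - i) else if (n : ℤ) ∣ m - j then m - (j - i) else m

theorem affineSwapFun_cases (n : ℕ) (i j m : ℤ) :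
    (∃ r : ℤ, m = i + r * n ∧ affineSwapFun n i j m = j + r * n) ∨
    (∃ r : ℤ, m = j + r * n ∧ affineSwapFun n i j m = i + r * n) ∨
    (¬ (n : ℤ) ∣ m - i ∧ ¬ (n : ℤ) ∣ m - j ∧ affineSwapFun n i j m = m) := by
  unfold affineSwapFun
  split_ifs with h1 h2
  · obtain ⟨r, hr⟩ := h1
    exact Or.inl ⟨r, by linarith, by linarith⟩
  · obtain ⟨r, hr⟩ := h2
    exact Or.inr (Or.inl ⟨r, by linarith, by linarith⟩)
  · exact Or.inr (Or.inr ⟨h1, h2, rfl⟩)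

theorem affineSwapFun_left (n : ℕ) (i j r : ℤ) : affineSwapFun n i j (i + r * n) = j + r * n := by
  rw [affineSwapFun, if_pos ⟨r, by ring⟩]; ring

theorem affineSwapFun_right (n : ℕ) (i j r : ℤ) (h : ¬ (n : ℤ) ∣ j - i) :
    affineSwapFun n i j (j + r * n) = i + r * n := by
  rw [affineSwapFun, if_neg, if_pos ⟨r, by ring⟩]
  · ring
  · intro hd
    exact h (by have := dvd_sub hd (Dvd.intro_left r rfl : (n : ℤ) ∣ r * n); ring_nf at this ⊢; exact this)

theorem affineSwapFun_involutive (n : ℕ) (i j : ℤ) (h : ¬ (n : ℤ) ∣ j - i) :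
    Function.Involutive (affineSwapFun n i j) := by
  intro m
  rcases affineSwapFun_cases n i j m with ⟨r, rfl, h2⟩ | ⟨r, rfl, h2⟩ | ⟨h1, h2, h3⟩
  · rw [h2, affineSwapFun_right _ _ _ _ h]
  · rw [h2, affineSwapFun_left]
  · rw [h3, h3]

/-- The affine transposition exchanging `i + r n` and `j + r n` for all `r`. -/
def affineSwap {n : ℕ} (i j : ℤ) (h : ¬ (n : ℤ) ∣ j - i) : AffinePerm n :=
  ⟨(affineSwapFun_involutive n i j h).toPerm, by
    intro m
    change affineSwapFun n i j (m + n) = affineSwapFun n i j m + n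
    have key : ∀ c : ℤ, ((n : ℤ) ∣ m + n - c) ↔ (n : ℤ) ∣ m - c := fun c => by
      rw [show m + n - c = (m - c) + n by ring]; exact dvd_add_self_right
    simp only [affineSwapFun, key]
    split_ifs <;> ring⟩

theorem affineSwap_cases {n : ℕ} (i j m : ℤ) (h : ¬ (n : ℤ) ∣ j - i) :
    (∃ r : ℤ, m = i + r * n ∧ (affineSwap i j h).1 m = j + r * n) ∨
    (∃ r : ℤ, m = j + r * n ∧ (affineSwap i j h).1 m = i + r * n) ∨
    (¬ (n : ℤ) ∣ m - i ∧ ¬ (n : ℤ) ∣ m - j ∧ (affineSwap i j h).1 m = m) :=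
  affineSwapFun_cases n i j m

theorem affineSwap_left {n : ℕ} (i j r : ℤ) (h : ¬ (n : ℤ) ∣ j - i) :
    (affineSwap i j h).1 (i + r * n) = j + r * n := affineSwapFun_left n i j r

theorem affineSwap_right {n : ℕ} (i j r : ℤ) (h : ¬ (n : ℤ) ∣ j - i) :
    (affineSwap i j h).1 (j + r * n) = i + r * n := affineSwapFun_right n i j r h

theorem affineSwap_apply_apply {n : ℕ} (i j m : ℤ) (h : ¬ (n : ℤ) ∣ j - i) :
    (affineSwap i j h).1 ((affineSwap i j h).1 m) = m := affineSwapFun_involutive n i j h m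

theorem affineSwap_mul_self {n : ℕ} (i j : ℤ) (h : ¬ (n : ℤ) ∣ j - i) :
    affineSwap i j h * affineSwap i j h = 1 := by
  ext m
  exact affineSwap_apply_apply i j m h

theorem isAffineReflection_affineSwap {n : ℕ} (i j : ℤ) (h : ¬ (n : ℤ) ∣ j - i) :
    IsAffineReflection (affineSwap i j h) := by
  refine ⟨i, j, fun hm => h (Int.modEq_iff_dvd.1 hm), fun r => ⟨affineSwap_left i j r h,
    affineSwap_right i j r h⟩, fun m h1 h2 => ?_⟩
  rcases affineSwap_cases i j m h with ⟨r, rfl, -⟩ | ⟨r, rfl, -⟩ | ⟨-, -, h3⟩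
  · exact absurd (by simp [Int.ModEq]) h1
  · exact absurd (by simp [Int.ModEq]) h2
  · exact h3

theorem IsAffineReflection.exists_affineSwap {n : ℕ} {t : AffinePerm n}
    (ht : IsAffineReflection t) :
    ∃ (i j : ℤ) (h : ¬ (n : ℤ) ∣ j - i), i < j ∧ t = affineSwap i j h := by
  obtain ⟨i, j, hij, h1, h2⟩ := ht
  have hd : ¬ (n : ℤ) ∣ j - i := fun h => hij (Int.modEq_iff_dvd.2 h)
  have hd' : ¬ (n : ℤ) ∣ i - j := fun h => hd (by rw [← neg_sub]; exact (dvd_neg).2 h)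
  have hne : i ≠ j := by rintro rfl; exact hd (by simp)
  have nm : ∀ a b : ℤ, ¬ (n : ℤ) ∣ a - b → ¬ a ≡ b [ZMOD n] := fun a b h hm =>
    h (Int.modEq_iff_dvd.1 hm.symm)
  rcases lt_or_gt_of_ne hne with hlt | hlt
  · refine ⟨i, j, hd, hlt, ?_⟩
    ext m
    rcases affineSwap_cases i j m hd with ⟨r, rfl, h⟩ | ⟨r, rfl, h⟩ | ⟨h, h', h''⟩
    · rw [h]; exact (h1 r).1
    · rw [h]; exact (h1 r).2
    · rw [h'']; exact h2 m (nm _ _ h) (nm _ _ h')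
  · refine ⟨j, i, hd', hlt, ?_⟩
    ext m
    rcases affineSwap_cases j i m hd' with ⟨r, rfl, h⟩ | ⟨r, rfl, h⟩ | ⟨h, h', h''⟩
    · rw [h]; exact (h1 r).2
    · rw [h]; exact (h1 r).1
    · rw [h'']; exact h2 m (nm _ _ h') (nm _ _ h)

/-! ### Finiteness of the length -/

theorem exists_displacement_bound {n : ℕ} [NeZero n] (f : AffinePerm n) :
    ∃ M : ℤ, ∀ i, |f.1 i - i| ≤ M := by
  have hn : (0 : ℤ) < n := by exact_mod_cast NeZero.pos n
  refine ⟨∑ i ∈ Finset.Ico (0 : ℤ) n, |f.1 i - i|, fun i => ?_⟩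
  have hi : f.1 i - i = f.1 (i % n) - i % n := by
    conv_lhs => rw [← Int.emod_add_mul_ediv i n, mul_comm, affine_apply_add_mul f]
    ring
  rw [hi]
  exact Finset.single_le_sum (f := fun i => |f.1 i - i|) (fun _ _ => abs_nonneg _)
    (Finset.mem_Ico.2 ⟨Int.emod_nonneg _ hn.ne', Int.emod_lt_of_pos _ hn⟩)

/-- Finiteness makes `affineLength` meaningful, since `Nat.card` is zero on infinite types. If
$|f(i)-i|\le M$, an inversion $p<q$ satisfies $q-p\le 2M$, and its class is determined by $p \bmod
n$ and $q-p$. -/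
instance {n : ℕ} [NeZero n] (f : AffinePerm n) : Finite (Quotient (affineInversionSetoid f)) := by
  have hn : (0 : ℤ) < n := by exact_mod_cast NeZero.pos n
  obtain ⟨M, hM⟩ := exists_displacement_bound f
  let S := (Finset.Ico (0 : ℤ) n) ×ˢ (Finset.Ioo (0 : ℤ) (2 * M + 1))
  have key : ∀ p : AffineInversion f, ((p.1.1 % n, p.1.2 - p.1.1) : ℤ × ℤ) ∈ S := by
    intro p
    have h1 := abs_le.1 (hM p.1.1)
    have h2 := abs_le.1 (hM p.1.2)
    have h3 := p.2
    rw [Finset.mem_product, Finset.mem_Ico, Finset.mem_Ioo]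
    exact ⟨⟨Int.emod_nonneg _ hn.ne', Int.emod_lt_of_pos _ hn⟩, by simp only; linarith,
      by simp only; linarith⟩
  refine Finite.of_injective (β := S) (Quotient.lift (fun p => ⟨_, key p⟩) ?_) ?_
  · rintro p q ⟨r, h1, h2⟩
    simp [h1, h2]
  · intro x y
    induction x using Quotient.inductionOn with | _ p
    induction y using Quotient.inductionOn with | _ q
    intro h
    simp only [Quotient.lift_mk, Subtype.mk.injEq, Prod.mk.injEq] at h
    obtain ⟨r, hr⟩ := Int.modEq_iff_dvd.1 (h.1 : p.1.1 ≡ q.1.1 [ZMOD n])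
    exact Quotient.sound ⟨r, by linarith, by linarith [h.2]⟩

/-! ### Length and affine transpositions -/

section Exchange

variable {n : ℕ} {i j : ℤ} (h : ¬ (n : ℤ) ∣ j - i) (f : AffinePerm n)

/-- The transposition moves the class of $i$ up and that of $j$ down by the same amount, so it can
destroy $p<q$ only if $p$ does not go down and $q$ does not go up. -/
theorem affineSwap_le_and_le (hij : i < j) {p q : ℤ} (hpq : p < q)
    (ht : ¬ (affineSwap i j h).1 p < (affineSwap i j h).1 q) :
    p ≤ (affineSwap i j h).1 p ∧ (affineSwap i j h).1 q ≤ q := by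
  rcases affineSwap_cases i j p h with ⟨r, rfl, h1⟩ | ⟨r, rfl, h1⟩ | ⟨h1, h2, h3⟩ <;>
  rcases affineSwap_cases i j q h with ⟨s, rfl, h4⟩ | ⟨s, rfl, h4⟩ | ⟨h4, h5, h6⟩ <;>
  (constructor <;> linarith)

theorem apply_affineSwap_le (hij : i < j) (hf : f.1 i < f.1 j) (p : ℤ) :
    (p ≤ (affineSwap i j h).1 p → f.1 p ≤ f.1 ((affineSwap i j h).1 p)) ∧
    ((affineSwap i j h).1 p ≤ p → f.1 ((affineSwap i j h).1 p) ≤ f.1 p) := by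
  rcases affineSwap_cases i j p h with ⟨r, rfl, h1⟩ | ⟨r, rfl, h1⟩ | ⟨h1, h2, h3⟩
  · rw [h1, affine_apply_add_mul f, affine_apply_add_mul f]
    constructor <;> intro <;> linarith
  · rw [h1, affine_apply_add_mul f, affine_apply_add_mul f]
    constructor <;> intro <;> linarith
  · rw [h3]; simp

/-- The map from inversions of `f` to inversions of `f t`, for a transposition `t`
increasing `f`. -/
def inversionMap (hij : i < j) (hf : f.1 i < f.1 j) (p : AffineInversion f) :
    AffineInversion (f * affineSwap i j h) :=
  if ht : (affineSwap i j h).1 p.1.1 < (affineSwap i j h).1 p.1.2 then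
    ⟨((affineSwap i j h).1 p.1.1, (affineSwap i j h).1 p.1.2), ht, by
      change f.1 ((affineSwap i j h).1 ((affineSwap i j h).1 p.1.2)) <
        f.1 ((affineSwap i j h).1 ((affineSwap i j h).1 p.1.1))
      rw [affineSwap_apply_apply, affineSwap_apply_apply]
      exact p.2.2⟩
  else
    ⟨p.1, p.2.1, by
      obtain ⟨h1, h2⟩ := affineSwap_le_and_le h hij p.2.1 ht
      change f.1 ((affineSwap i j h).1 p.1.2) < f.1 ((affineSwap i j h).1 p.1.1)
      have h3 := (apply_affineSwap_le h f hij hf p.1.1).1 h1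
      have h4 := (apply_affineSwap_le h f hij hf p.1.2).2 h2
      have h5 := p.2.2
      linarith⟩

theorem inversionMap_of_lt (hij : i < j) (hf : f.1 i < f.1 j) (p : AffineInversion f)
    (ht : (affineSwap i j h).1 p.1.1 < (affineSwap i j h).1 p.1.2) :
    (inversionMap h f hij hf p).1 = ((affineSwap i j h).1 p.1.1, (affineSwap i j h).1 p.1.2) := by
  exact congrArg Subtype.val (dif_pos ht)

theorem inversionMap_of_not_lt (hij : i < j) (hf : f.1 i < f.1 j) (p : AffineInversion f)
    (ht : ¬ (affineSwap i j h).1 p.1.1 < (affineSwap i j h).1 p.1.2) :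
    (inversionMap h f hij hf p).1 = p.1 := by
  exact congrArg Subtype.val (dif_neg ht)

/-- The map of `inversionMap` on classes, completed by the class of `(i, j)`. -/
def inversionClassMap (hij : i < j) (hf : f.1 i < f.1 j) :
    Option (Quotient (affineInversionSetoid f)) →
      Quotient (affineInversionSetoid (f * affineSwap i j h))
  | none => Quotient.mk _ ⟨(i, j), hij, by
      change f.1 ((affineSwap i j h).1 j) < f.1 ((affineSwap i j h).1 i)
      have h1 := affineSwap_left i j 0 h
      have h2 := affineSwap_right i j 0 h
      simp only [zero_mul, add_zero] at h1 h2
      rw [h1, h2]; exact hf⟩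
  | some x => Quotient.map (inversionMap h f hij hf) (by
      rintro p q ⟨r, h1, h2⟩
      have ht : ∀ m, (affineSwap i j h).1 (m + r * n) = (affineSwap i j h).1 m + r * n :=
        fun m => affine_apply_add_mul _ m r
      have hlt : (affineSwap i j h).1 q.1.1 < (affineSwap i j h).1 q.1.2 ↔
          (affineSwap i j h).1 p.1.1 < (affineSwap i j h).1 p.1.2 := by
        rw [h1, h2, ht, ht, add_lt_add_iff_right]
      by_cases hs : (affineSwap i j h).1 p.1.1 < (affineSwap i j h).1 p.1.2
      · refine ⟨r, ?_, ?_⟩ <;>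
          rw [inversionMap_of_lt h f hij hf p hs, inversionMap_of_lt h f hij hf q (hlt.2 hs)]
        · simp only [h1, ht]
        · simp only [h2, ht]
      · refine ⟨r, ?_, ?_⟩ <;>
          rw [inversionMap_of_not_lt h f hij hf p hs,
            inversionMap_of_not_lt h f hij hf q (mt hlt.1 hs)]
        · exact h1
        · exact h2) x

/-- The two branches of `inversionMap` have disjoint images: as $t$ is an involution, it keeps the
order of a pair from the first branch and destroys that of a pair from the second. The class of
$(i,j)$ is new because $(i,j)$ is not an inversion of $f$ and $(j,i)$ is not increasing. -/
theorem inversionClassMap_injective (hij : i < j) (hf : f.1 i < f.1 j) :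
    Function.Injective (inversionClassMap h f hij hf) := by
  have ht : ∀ m r : ℤ, (affineSwap i j h).1 (m + r * n) = (affineSwap i j h).1 m + r * n :=
        fun m r => affine_apply_add_mul _ m r
  have hti : (affineSwap i j h).1 i = j := by simpa using affineSwap_left i j 0 h
  have htj : (affineSwap i j h).1 j = i := by simpa using affineSwap_right i j 0 h
  have key : ∀ p : AffineInversion f, ¬ (affineInversionSetoid (f * affineSwap i j h)).r
      ⟨(i, j), hij, by change f.1 ((affineSwap i j h).1 j) < f.1 ((affineSwap i j h).1 i)
                       rw [hti, htj]; exact hf⟩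
      (inversionMap h f hij hf p) := by
    rintro p ⟨r, h1, h2⟩
    have hp2 := p.2.2
    by_cases hs : (affineSwap i j h).1 p.1.1 < (affineSwap i j h).1 p.1.2
    · rw [inversionMap_of_lt h f hij hf p hs] at h1 h2
      have h1' := congrArg (affineSwap i j h).1 h1
      have h2' := congrArg (affineSwap i j h).1 h2
      rw [affineSwap_apply_apply, ht, hti] at h1'
      rw [affineSwap_apply_apply, ht, htj] at h2'
      have := p.2.1
      linarith
    · rw [inversionMap_of_not_lt h f hij hf p hs] at h1 h2
      rw [h1, h2, affine_apply_add_mul f, affine_apply_add_mul f] at hp2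
      linarith
  rintro (_ | x) (_ | y) hxy
  · rfl
  · induction y using Quotient.inductionOn with | _ q
    exact absurd (Quotient.exact hxy) (key q)
  · induction x using Quotient.inductionOn with | _ q
    exact absurd (Quotient.exact hxy.symm) (key q)
  · induction x using Quotient.inductionOn with | _ p
    induction y using Quotient.inductionOn with | _ q
    congr 1
    obtain ⟨r, h1, h2⟩ := Quotient.exact hxy
    apply Quotient.sound
    have hp := p.2.1
    have hq := q.2.1
    by_cases hs : (affineSwap i j h).1 p.1.1 < (affineSwap i j h).1 p.1.2 <;>
    by_cases hs' : (affineSwap i j h).1 q.1.1 < (affineSwap i j h).1 q.1.2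
    · rw [inversionMap_of_lt h f hij hf p hs, inversionMap_of_lt h f hij hf q hs'] at h1 h2
      refine ⟨r, ?_, ?_⟩
      · have := congrArg (affineSwap i j h).1 h1
        rwa [affineSwap_apply_apply, ht, affineSwap_apply_apply] at this
      · have := congrArg (affineSwap i j h).1 h2
        rwa [affineSwap_apply_apply, ht, affineSwap_apply_apply] at this
    · rw [inversionMap_of_lt h f hij hf p hs, inversionMap_of_not_lt h f hij hf q hs'] at h1 h2
      rw [h1, h2, ht, ht, affineSwap_apply_apply, affineSwap_apply_apply] at hs'
      omega
    · rw [inversionMap_of_not_lt h f hij hf p hs, inversionMap_of_lt h f hij hf q hs'] at h1 h2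
      have h1' := congrArg (affineSwap i j h).1 h1
      have h2' := congrArg (affineSwap i j h).1 h2
      rw [ht, affineSwap_apply_apply] at h1' h2'
      omega
    · rw [inversionMap_of_not_lt h f hij hf p hs, inversionMap_of_not_lt h f hij hf q hs'] at h1 h2
      exact ⟨r, h1, h2⟩

theorem affineLength_lt_mul_affineSwap [NeZero n] (hij : i < j) (hf : f.1 i < f.1 j) :
    affineLength f + 1 ≤ affineLength (f * affineSwap i j h) := by
  have := Nat.card_le_card_of_injective _ (inversionClassMap_injective h f hij hf)
  rwa [Finite.card_option] at this

/-- The only inversions of $ft$ to worry about are those whose order $t$ destroys and which are not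
inversions of $f$. If $t$ moves both entries, $j<i+n$ makes the pair a translate of $(i,j)$. If it
moves just one, the other entry lies between translates of $i$ and $j$ in position and in value,
which `hcov` forbids. -/
theorem inversionClassMap_surjective (hij : i < j) (hf : f.1 i < f.1 j) (hjn : j < i + n)
    (hcov : ∀ p, i < p → p < j → f.1 i < f.1 p → ¬ f.1 p < f.1 j) :
    Function.Surjective (inversionClassMap h f hij hf) := by
  have ht : ∀ m r : ℤ, (affineSwap i j h).1 (m + r * n) = (affineSwap i j h).1 m + r * n :=
        fun m r => affine_apply_add_mul _ m r
  have hcov' : ∀ p r : ℤ, i + r * n < p → p < j + r * n → f.1 (i + r * n) < f.1 p →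
      ¬ f.1 p < f.1 (j + r * n) := by
    intro p r h1 h2 h3 h4
    have h5 := affine_apply_add_mul f (p + (-r) * n) r
    rw [show p + -r * n + r * n = p by ring] at h5
    rw [affine_apply_add_mul f] at h3 h4
    exact hcov (p + (-r) * n) (by linarith) (by linarith) (by linarith) (by linarith)
  intro y
  induction y using Quotient.inductionOn with | _ q
  obtain ⟨⟨p, q⟩, hpq, hq⟩ := q
  change f.1 ((affineSwap i j h).1 q) < f.1 ((affineSwap i j h).1 p) at hq
  simp only at hpq
  by_cases hs : (affineSwap i j h).1 p < (affineSwap i j h).1 q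
  · refine ⟨some (Quotient.mk _ ⟨((affineSwap i j h).1 p, (affineSwap i j h).1 q), hs, hq⟩), ?_⟩
    apply Quotient.sound
    refine ⟨0, ?_, ?_⟩ <;> simp [inversionMap, affineSwap_apply_apply, hpq]
  · by_cases hfpq : f.1 q < f.1 p
    · refine ⟨some (Quotient.mk _ ⟨(p, q), hpq, hfpq⟩), ?_⟩
      apply Quotient.sound
      refine ⟨0, ?_, ?_⟩ <;> simp [inversionMap, hs]
    · have hfpq' : f.1 p < f.1 q := lt_of_le_of_ne (not_lt.1 hfpq)
        (fun e => hpq.ne (f.1.injective e))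
      refine ⟨none, Quotient.sound ?_⟩
      rcases affineSwap_cases i j p h with ⟨r, rfl, h1⟩ | ⟨r, rfl, h1⟩ | ⟨h1, h2, h3⟩ <;>
      rcases affineSwap_cases i j q h with ⟨s, rfl, h4⟩ | ⟨s, rfl, h4⟩ | ⟨h4, h5, h6⟩
      · rw [h1, h4] at hs; linarith
      · have hn : (0 : ℤ) < n := by linarith
        rw [h1, h4] at hs
        have hsr : s = r := by
          have h5 : (s - r) * n < 1 * n := by
            linarith
          have h6 : (-1) * (n : ℤ) < (s - r) * n := by
            linarith
          have := lt_of_mul_lt_mul_right h5 hn.le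
          have := lt_of_mul_lt_mul_right h6 hn.le
          omega
        subst hsr
        exact ⟨s, rfl, rfl⟩
      · rw [h1, h6] at hs hq
        have : q ≠ j + r * n := by rintro rfl; exact h5 ⟨r, by ring⟩
        exact absurd hq (hcov' q r hpq (lt_of_le_of_ne (not_lt.1 hs) this) hfpq')
      · rw [h1, h4] at hs; linarith
      · rw [h1, h4] at hs; linarith
      · rw [h1, h6] at hs; linarith
      · rw [h3, h4] at hs; linarith
      · rw [h3, h4] at hs hq
        have : p ≠ i + s * n := by rintro rfl; exact h1 ⟨s, by ring⟩
        exact absurd hfpq' (hcov' p s (lt_of_le_of_ne (not_lt.1 hs) this.symm) hpq hq)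
      · rw [h3, h6] at hs; exact absurd hpq hs

theorem affineLength_mul_affineSwap_of_cover [NeZero n] (hij : i < j) (hf : f.1 i < f.1 j)
    (hjn : j < i + n) (hcov : ∀ p, i < p → p < j → f.1 i < f.1 p → ¬ f.1 p < f.1 j) :
    affineLength (f * affineSwap i j h) = affineLength f + 1 := by
  refine le_antisymm ?_ (affineLength_lt_mul_affineSwap h f hij hf)
  have := Nat.card_le_card_of_surjective _ (inversionClassMap_surjective h f hij hf hjn hcov)
  rwa [Finite.card_option] at this

end Exchange

/-! ### The affine permutation `f_{u,w}` -/

section FuwApply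

variable {n : ℕ} [NeZero n]

theorem window_symm_apply (q : ℤ) (a : Fin n) :
    (window n).symm (q, a) = q * n + (a.val : ℤ) + 1 := by
  simp [window, Int.divModEquiv]

theorem window_apply (q : ℤ) (a : Fin n) :
    window n (q * n + (a.val : ℤ) + 1) = (q, a) := by
  rw [← window_symm_apply, Equiv.apply_symm_apply]

theorem exists_eq_window (w : Equiv.Perm (Fin n)) (p : ℤ) :
    ∃ (q : ℤ) (a : Fin n), p = q * n + ((w a).val : ℤ) + 1 := by
  refine ⟨(window n p).1, w.symm (window n p).2, ?_⟩
  rw [Equiv.apply_symm_apply, ← window_symm_apply]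
  simp

theorem extendPerm_apply (u : Equiv.Perm (Fin n)) (q : ℤ) (a : Fin n) :
    (extendPerm u).1 (q * n + (a.val : ℤ) + 1) = q * n + ((u a).val : ℤ) + 1 := by
  rw [← window_symm_apply, ← window_symm_apply]
  simp [extendPerm]

theorem extendPerm_inv_apply (w : Equiv.Perm (Fin n)) (q : ℤ) (a : Fin n) :
    ((extendPerm w)⁻¹).1 (q * n + ((w a).val : ℤ) + 1) = q * n + (a.val : ℤ) + 1 := by
  change (extendPerm w).1.symm _ = _
  rw [Equiv.symm_apply_eq, extendPerm_apply]

theorem translation_apply (μ : Fin n → ℤ) (q : ℤ) (a : Fin n) :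
    (translation μ).1 (q * n + (a.val : ℤ) + 1) = (q + μ a) * n + (a.val : ℤ) + 1 := by
  change (n : ℤ) * μ (window n (q * n + (a.val : ℤ) + 1)).2 + _ = _
  rw [window_apply]; ring

theorem fuw_apply (k : ℕ) (u w : Equiv.Perm (Fin n)) (q : ℤ) (a : Fin n) :
    (fuw k u w).1 (q * n + ((w a).val : ℤ) + 1) =
      (q + omega k n a) * n + ((u a).val : ℤ) + 1 := by
  change (extendPerm u).1 ((translation (omega k n)).1 (((extendPerm w)⁻¹).1 _)) = _
  rw [extendPerm_inv_apply, translation_apply, extendPerm_apply]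

theorem fuw_apply_zero (k : ℕ) (u w : Equiv.Perm (Fin n)) (a : Fin n) :
    (fuw k u w).1 (((w a).val : ℤ) + 1) = omega k n a * n + ((u a).val : ℤ) + 1 := by
  simpa using fuw_apply k u w 0 a

theorem eq_fuw_of_forall (k : ℕ) (u w : Equiv.Perm (Fin n)) (f : AffinePerm n)
    (h : ∀ a, f.1 (((w a).val : ℤ) + 1) = omega k n a * n + ((u a).val : ℤ) + 1) :
    f = fuw k u w := by
  ext p
  obtain ⟨q, a, rfl⟩ := exists_eq_window w p
  rw [fuw_apply, show q * n + ((w a).val : ℤ) + 1 = ((w a).val + 1) + q * n by ring,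
    affine_apply_add_mul f, h]
  ring

theorem fuw_left_injective (k : ℕ) (u u' w : Equiv.Perm (Fin n))
    (h : fuw k u w = fuw k u' w) : u = u' := by
  ext a
  have h1 := fuw_apply_zero k u w a
  rw [h, fuw_apply_zero] at h1
  omega

theorem fuw_mul_right (k : ℕ) (u w z : Equiv.Perm (Fin n)) (hz : InParabolic k z) :
    fuw k (u * z) (w * z) = fuw k u w := by
  apply eq_fuw_of_forall
  intro a
  obtain ⟨b, rfl⟩ := z.surjective a
  rw [← Equiv.Perm.mul_apply, fuw_apply_zero]
  simp [omega, hz b]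

end FuwApply

/-! ### The length of `f_{u,w}` -/

section Length

variable {n : ℕ}

/-- Two positions lie in the same block of `{1,…,k} ∪ {k+1,…,n}`. -/
def SameBlock (k : ℕ) (a b : Fin n) : Prop := a.val < k ↔ b.val < k

instance (k : ℕ) (a b : Fin n) : Decidable (SameBlock k a b) := by
  unfold SameBlock; infer_instance

/-- The number of pairs of positions in a common block which are inverted by `w` but not
by `u`. -/
def blockDefect (k : ℕ) (u w : Equiv.Perm (Fin n)) : ℕ :=
  (Finset.univ.filter fun p : Fin n × Fin n =>
    p.1 < p.2 ∧ SameBlock k p.1 p.2 ∧ u p.1 < u p.2 ∧ w p.2 < w p.1).card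

/-- The inversions of `f_{u,w}` starting at `w(a)` and ending at `w(b) + m n`. -/
def FuwInversion (k : ℕ) (u w : Equiv.Perm (Fin n)) (x : (Fin n × Fin n) × ℤ) : Prop :=
  ((w x.1.1).val : ℤ) < (w x.1.2).val + x.2 * n ∧
    ((u x.1.2).val : ℤ) + (omega k n x.1.2 + x.2) * n < (u x.1.1).val + omega k n x.1.1 * n

instance (k : ℕ) (u w : Equiv.Perm (Fin n)) : DecidablePred (FuwInversion k u w) := fun x => by
  unfold FuwInversion; infer_instance

theorem omega_cases (k : ℕ) (a : Fin n) :
    (a.val < k ∧ omega k n a = 1) ∨ (¬ a.val < k ∧ omega k n a = 0) := by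
  unfold omega; split_ifs with h <;> simp [h]

/-- Increasing positions force the shift to be nonnegative. Since $f_{u,w}$ maps $[n]$ into $[2n]$,
decreasing values force it below $2$. -/
theorem FuwInversion.shift_mem {k : ℕ} {u w : Equiv.Perm (Fin n)} {x : (Fin n × Fin n) × ℤ}
    (h : FuwInversion k u w x) : x.2 = 0 ∨ x.2 = 1 := by
  obtain ⟨h1, h2⟩ := h
  have := (w x.1.1).isLt
  have := (w x.1.2).isLt
  have := (u x.1.1).isLt
  have := (u x.1.2).isLt
  have hn : (0 : ℤ) < n := by omega
  have h3 : -1 < x.2 := by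
    by_contra hc
    have : x.2 * n ≤ (-1) * n := mul_le_mul_of_nonneg_right (by omega) hn.le
    omega
  have h4 : x.2 < 2 := by
    by_contra hc
    have : 2 * (n : ℤ) ≤ x.2 * n := mul_le_mul_of_nonneg_right (by omega) hn.le
    rw [add_mul] at h2
    rcases omega_cases k x.1.1 with ⟨_, h5⟩ | ⟨_, h5⟩ <;>
    rcases omega_cases k x.1.2 with ⟨_, h6⟩ | ⟨_, h6⟩ <;> rw [h5, h6] at h2 <;> omega
  omega

/-- Each class of inversions has exactly one representative whose smaller position lies in $[n]$. -/
theorem affineLength_fuw_eq_card [NeZero n] (k : ℕ) (u w : Equiv.Perm (Fin n)) :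
    affineLength (fuw k u w) =
      (((Finset.univ : Finset (Fin n × Fin n)) ×ˢ ({0, 1} : Finset ℤ)).filter
        (FuwInversion k u w)).card := by
  set T := ((Finset.univ : Finset (Fin n × Fin n)) ×ˢ ({0, 1} : Finset ℤ)).filter
        (FuwInversion k u w) with hT
  have key : ∀ x : T, FuwInversion k u w x.1 := fun x => (Finset.mem_filter.1 x.2).2
  let F : T → Quotient (affineInversionSetoid (fuw k u w)) := fun x =>
    Quotient.mk _ ⟨(0 * n + ((w x.1.1.1).val : ℤ) + 1, x.1.2 * n + ((w x.1.1.2).val : ℤ) + 1), by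
      have := (key x).1
      simp only; linarith, by
      have := (key x).2
      simp only [fuw_apply]; linarith⟩
  have hF : Function.Bijective F := by
    constructor
    · intro x y hxy
      obtain ⟨r, h1, h2⟩ := Quotient.exact hxy
      simp only at h1 h2
      have h1' : 0 * (n : ℤ) + ((w y.1.1.1).val : ℤ) + 1 = r * n + ((w x.1.1.1).val : ℤ) + 1 := by
        linarith
      have h2' : y.1.2 * (n : ℤ) + ((w y.1.1.2).val : ℤ) + 1 =
          (x.1.2 + r) * n + ((w x.1.1.2).val : ℤ) + 1 := by
        linarith
      have h1'' := congrArg (window n) h1'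
      have h2'' := congrArg (window n) h2'
      rw [window_apply, window_apply, Prod.mk.injEq] at h1'' h2''
      apply Subtype.ext
      refine Prod.ext (Prod.ext (w.injective h1''.2.symm) (w.injective h2''.2.symm)) ?_
      have := h1''.1
      have := h2''.1
      omega
    · intro y
      induction y using Quotient.inductionOn with | _ y
      obtain ⟨⟨p, q⟩, h1, h2⟩ := y
      obtain ⟨r, a, rfl⟩ := exists_eq_window w p
      obtain ⟨s, b, rfl⟩ := exists_eq_window w q
      simp only [fuw_apply] at h1 h2
      have hI : FuwInversion k u w ((a, b), s - r) := by
        constructor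
        · simp only; linarith
        · simp only; linarith
      refine ⟨⟨((a, b), s - r), ?_⟩, Quotient.sound ⟨r, ?_, ?_⟩⟩
      · rw [hT, Finset.mem_filter]
        refine ⟨?_, hI⟩
        have := hI.shift_mem
        simpa using this
      · simp only; ring
      · simp only; ring
  rw [affineLength, ← Nat.card_eq_of_bijective F hF, Nat.card_eq_fintype_card, Fintype.card_coe]

theorem card_filter_pair (P : Fin n × Fin n → Prop) [DecidablePred P] :
    ((Finset.univ.filter P).card : ℤ) = ∑ a : Fin n, ∑ b : Fin n, if P (a, b) then 1 else 0 := by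
  rw [Finset.card_filter, ← Finset.univ_product_univ, Finset.sum_product]
  push_cast
  rfl

theorem card_cross_pairs (k : ℕ) (hk : k ≤ n) :
    (k : ℤ) * (n - k) = ∑ a : Fin n, ∑ b : Fin n, if a.val < k ∧ ¬ b.val < k then 1 else 0 := by
  have h1 : ((Finset.univ.filter fun a : Fin n => a.val < k).card : ℤ) = k := by
    rw [Fin.card_filter_val_lt, min_eq_right hk]
  have h2 : ((Finset.univ.filter fun a : Fin n => ¬ a.val < k).card : ℤ) = n - k := by
    have := Finset.card_filter_add_card_filter_not (s := (Finset.univ : Finset (Fin n)))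
      (fun a => a.val < k)
    rw [Finset.card_univ, Fintype.card_fin] at this
    omega
  rw [← card_filter_pair (fun p => p.1.val < k ∧ ¬ p.2.val < k), ← h2]
  conv_lhs => rw [← h1]
  rw [← Nat.cast_mul, ← Finset.card_product]
  congr 2
  ext; simp

/-- Inversions of $f$ do not respect the order of $a$ and $b$, so the count is correct only after
symmetrization. For a pair in one block, $f$ has one inversion if exactly one of $u,w$ inverts the
pair and none otherwise. For $a\le k<b$, the shifts $0$ and $1$ are inversions exactly when
$w(a)<w(b)$ and $u(b)<u(a)$ respectively. Adding the inversions of $w$ gives the right-hand side in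
both cases. -/
theorem pair_count_identity {k : ℕ} (u w : Equiv.Perm (Fin n)) (a b : Fin n) :
    let F := fun a b : Fin n => ((if FuwInversion k u w ((a, b), 0) then 1 else 0) +
      (if FuwInversion k u w ((a, b), 1) then 1 else 0) : ℤ) +
      (if a < b ∧ w b < w a then 1 else 0)
    let G := fun a b : Fin n => (if a.val < k ∧ ¬ b.val < k then 1 else 0 : ℤ) +
      (if a < b ∧ u b < u a then 1 else 0) +
      2 * (if a < b ∧ SameBlock k a b ∧ u a < u b ∧ w b < w a then 1 else 0)
    F a b + F b a = G a b + G b a := by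
  have h1 := (w a).isLt
  have h2 := (w b).isLt
  have h3 := (u a).isLt
  have h4 := (u b).isLt
  rcases eq_or_ne a b with rfl | hab
  · rcases omega_cases k a with ⟨h5, h5'⟩ | ⟨h5, h5'⟩ <;> simp [FuwInversion, h5, h5'] <;> omega
  have hw : w b < w a ↔ ¬ w a < w b := by
    rw [not_lt, lt_iff_le_and_ne, and_iff_left (w.injective.ne hab.symm)]
  have hu : u b < u a ↔ ¬ u a < u b := by
    rw [not_lt, lt_iff_le_and_ne, and_iff_left (u.injective.ne hab.symm)]
  have hb : b < a ↔ ¬ a < b := by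
    rw [not_lt, lt_iff_le_and_ne, and_iff_left hab.symm]
  intro F G
  have key : ∀ a b : Fin n, FuwInversion k u w ((a, b), 0) ↔
      (SameBlock k a b ∧ w a < w b ∧ u b < u a) ∨ (a.val < k ∧ ¬ b.val < k ∧ w a < w b) := by
    intro a b
    have h1 := (w a).isLt
    have h2 := (w b).isLt
    have h3 := (u a).isLt
    have h4 := (u b).isLt
    simp only [FuwInversion, SameBlock, Fin.lt_def]
    rcases omega_cases k a with ⟨h5, h5'⟩ | ⟨h5, h5'⟩ <;>
    rcases omega_cases k b with ⟨h6, h6'⟩ | ⟨h6, h6'⟩ <;> rw [h5', h6'] <;> omega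
  have key' : ∀ a b : Fin n, FuwInversion k u w ((a, b), 1) ↔
      (a.val < k ∧ ¬ b.val < k ∧ u b < u a) := by
    intro a b
    have h1 := (w a).isLt
    have h2 := (w b).isLt
    have h3 := (u a).isLt
    have h4 := (u b).isLt
    simp only [FuwInversion, Fin.lt_def]
    rcases omega_cases k a with ⟨h5, h5'⟩ | ⟨h5, h5'⟩ <;>
    rcases omega_cases k b with ⟨h6, h6'⟩ | ⟨h6, h6'⟩ <;> rw [h5', h6'] <;> omega
  simp only [F, G, key, key', hw, hu, hb, SameBlock]
  by_cases c1 : a < b <;> by_cases c2 : w a < w b <;> by_cases c3 : u a < u b <;>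
  by_cases c4 : a.val < k <;> by_cases c5 : b.val < k <;> simp [c1, c2, c3, c4, c5] <;>
  simp only [Fin.lt_def] at * <;> omega

/-- The length of `f_{u,w}` for arbitrary `u` and `w`. -/
theorem affineLength_fuw [NeZero n] {k : ℕ} (hk : k ≤ n) (u w : Equiv.Perm (Fin n)) :
    (affineLength (fuw k u w) : ℤ) + permLength w =
      k * (n - k) + permLength u + 2 * blockDefect k u w := by
  rw [affineLength_fuw_eq_card, Finset.card_filter, Finset.sum_product, permLength, permLength,
    blockDefect, card_filter_pair, card_filter_pair, card_filter_pair, card_cross_pairs k hk,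
    ← Finset.univ_product_univ, Finset.sum_product]
  push_cast
  simp only [Finset.sum_pair (zero_ne_one' ℤ), Finset.mul_sum, ← Finset.sum_add_distrib]
  have key := fun a b => pair_count_identity (k := k) u w a b
  simp only at key
  set F := fun a b : Fin n => ((if FuwInversion k u w ((a, b), 0) then 1 else 0) +
      (if FuwInversion k u w ((a, b), 1) then 1 else 0) : ℤ) +
      (if a < b ∧ w b < w a then 1 else 0) with hF
  set G := fun a b : Fin n => (if a.val < k ∧ ¬ b.val < k then 1 else 0 : ℤ) +
      (if a < b ∧ u b < u a then 1 else 0) +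
      2 * (if a < b ∧ SameBlock k a b ∧ u a < u b ∧ w b < w a then 1 else 0) with hG
  change ∑ a, ∑ b, F a b = ∑ a, ∑ b, G a b
  -- The pairwise identity is symmetrized, so summing it over all ordered pairs gives twice the
  -- desired equation.
  have h1 : ∑ a, ∑ b, (F a b + F b a) = ∑ a, ∑ b, (G a b + G b a) :=
    Finset.sum_congr rfl fun a _ => Finset.sum_congr rfl fun b _ => key a b
  simp only [Finset.sum_add_distrib (f := fun _ => F _ _), Finset.sum_add_distrib] at h1
  have h2 : ∑ a, ∑ b, F b a = ∑ a, ∑ b, F a b := Finset.sum_comm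
  have h3 : ∑ a, ∑ b, G b a = ∑ a, ∑ b, G a b := Finset.sum_comm
  linarith

end Length

/-! ### Transpositions in the symmetric group -/

section Finite

variable {n : ℕ}

theorem not_dvd_val_sub (a b : Fin n) (hab : a ≠ b) (m : ℤ) :
    ¬ (n : ℤ) ∣ ((b.val : ℤ) + 1 + m * n) - ((a.val : ℤ) + 1) := by
  rintro ⟨c, hc⟩
  have h1 := a.isLt
  have h2 := b.isLt
  have hn : (0 : ℤ) < n := by omega
  have h3 : (c - m) * n < 1 * n := by linarith
  have h4 : (-1) * (n : ℤ) < (c - m) * n := by linarith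
  have h5 := lt_of_mul_lt_mul_right h3 hn.le
  have h6 := lt_of_mul_lt_mul_right h4 hn.le
  have : c = m := by omega
  subst this
  apply hab
  ext
  have : (b.val : ℤ) = a.val := by linarith
  omega

theorem not_dvd_val_sub_zero (a b : Fin n) (hab : a ≠ b) :
    ¬ (n : ℤ) ∣ ((b.val : ℤ) + 1) - ((a.val : ℤ) + 1) := by
  simpa using not_dvd_val_sub a b hab 0

variable [NeZero n]

theorem fuw_mul_affineSwap (k : ℕ) (u w : Equiv.Perm (Fin n)) {a b : Fin n} (hab : a ≠ b) :
    fuw k u w * affineSwap (((w a).val : ℤ) + 1) (((w b).val : ℤ) + 1)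
      (not_dvd_val_sub_zero _ _ (w.injective.ne hab)) = fuw k u (w * Equiv.swap a b) := by
  set h := not_dvd_val_sub_zero _ _ (w.injective.ne hab)
  apply eq_fuw_of_forall
  intro c
  change (fuw k u w).1 ((affineSwap _ _ h).1 _) = _
  rw [Equiv.Perm.mul_apply]
  by_cases hca : c = a
  · subst hca
    have h1 := affineSwap_right _ _ 0 h
    simp only [zero_mul, add_zero] at h1
    rw [Equiv.swap_apply_left, h1, fuw_apply_zero]
  by_cases hcb : c = b
  · subst hcb
    have h1 := affineSwap_left _ _ 0 h
    simp only [zero_mul, add_zero] at h1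
    rw [Equiv.swap_apply_right, h1, fuw_apply_zero]
  rw [Equiv.swap_apply_of_ne_of_ne hca hcb]
  rcases affineSwap_cases _ _ (((w c).val : ℤ) + 1) h with ⟨r, h1, h2⟩ | ⟨r, h1, h2⟩ | ⟨h1, h2, h3⟩
  · exact absurd ⟨r, by rw [h1]; ring⟩ (not_dvd_val_sub_zero (w a) (w c) (w.injective.ne (Ne.symm hca)))
  · exact absurd ⟨r, by rw [h1]; ring⟩ (not_dvd_val_sub_zero (w b) (w c) (w.injective.ne (Ne.symm hcb)))
  · rw [h3, fuw_apply_zero]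

theorem inParabolic_swap {k : ℕ} {a b : Fin n} (h : SameBlock k a b) :
    InParabolic k (Equiv.swap a b) := by
  intro c
  unfold SameBlock at h
  by_cases hca : c = a
  · subst hca; rw [Equiv.swap_apply_left]; exact h.symm
  by_cases hcb : c = b
  · subst hcb; rw [Equiv.swap_apply_right]; exact h
  rw [Equiv.swap_apply_of_ne_of_ne hca hcb]

theorem fuw_mul_swap_swap (k : ℕ) (u w : Equiv.Perm (Fin n)) {a b : Fin n}
    (h : SameBlock k a b) : fuw k u (w * Equiv.swap a b) = fuw k (u * Equiv.swap a b) w := by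
  rw [← fuw_mul_right k _ w _ (inParabolic_swap h), mul_assoc, Equiv.swap_mul_self, mul_one]

/-- The translation absorbs the shift: $f$ takes $w(a)$ and $w(b)+n$ to $u(a)+n$ and $u(b)+n$, so
exchanging these positions exchanges values of $u$. -/
theorem fuw_mul_affineSwap_shift (k : ℕ) (u w : Equiv.Perm (Fin n)) {a b : Fin n} (hab : a ≠ b)
    (ha : a.val < k) (hb : ¬ b.val < k) :
    fuw k u w * affineSwap (((w a).val : ℤ) + 1) (((w b).val : ℤ) + 1 + 1 * n)
      (not_dvd_val_sub _ _ (w.injective.ne hab) 1) = fuw k (u * Equiv.swap a b) w := by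
  set h := not_dvd_val_sub _ _ (w.injective.ne hab) 1
  have ha' : omega k n a = 1 := by simp [omega, ha]
  have hb' : omega k n b = 0 := by simp [omega, hb]
  apply eq_fuw_of_forall
  intro c
  change (fuw k u w).1 ((affineSwap _ _ h).1 _) = _
  rw [Equiv.Perm.mul_apply]
  by_cases hca : c = a
  · subst hca
    have h1 := affineSwap_left _ _ 0 h
    simp only [zero_mul, add_zero] at h1
    rw [Equiv.swap_apply_left, h1, affine_apply_add_mul, fuw_apply_zero, ha', hb']
    ring
  by_cases hcb : c = b
  · subst hcb
    have h1 := affineSwap_right _ _ (-1) h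
    rw [show (((w c).val : ℤ) + 1 + 1 * n) + (-1) * n = (w c).val + 1 by ring] at h1
    rw [Equiv.swap_apply_right, h1, affine_apply_add_mul, fuw_apply_zero, ha', hb']
    ring
  rw [Equiv.swap_apply_of_ne_of_ne hca hcb]
  rcases affineSwap_cases _ _ (((w c).val : ℤ) + 1) h with ⟨r, h1, h2⟩ | ⟨r, h1, h2⟩ | ⟨h1, h2, h3⟩
  · exact absurd ⟨r, by rw [h1]; ring⟩ (not_dvd_val_sub_zero (w a) (w c) (w.injective.ne (Ne.symm hca)))
  · exact absurd ⟨r + 1, by rw [h1]; ring⟩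
      (not_dvd_val_sub_zero (w b) (w c) (w.injective.ne (Ne.symm hcb)))
  · rw [h3, fuw_apply_zero]

theorem permLength_one : permLength (1 : Equiv.Perm (Fin n)) = 0 := by
  rw [permLength, Finset.card_eq_zero, Finset.filter_eq_empty_iff]
  rintro p - ⟨h1, h2⟩
  exact lt_asymm h1 h2

/-- For $k=0$ the translation is trivial and $f_{u,1}$ is the periodic extension of $u$. The affine
exchange lemmas thereby give those for $S_n$. -/
theorem affineLength_fuw_zero_one (u : Equiv.Perm (Fin n)) :
    affineLength (fuw 0 u 1) = permLength u := by
  have h := affineLength_fuw (Nat.zero_le n) u 1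
  have h0 : blockDefect 0 u 1 = 0 := by
    rw [blockDefect, Finset.card_eq_zero, Finset.filter_eq_empty_iff]
    rintro p - ⟨h1, -, -, h2⟩
    exact lt_asymm h1 h2
  rw [permLength_one, h0] at h
  push_cast at h
  omega

theorem fuw_zero_mul_affineSwap (u : Equiv.Perm (Fin n)) {a b : Fin n} (hab : a ≠ b) :
    fuw 0 u 1 * affineSwap ((a.val : ℤ) + 1) ((b.val : ℤ) + 1) (not_dvd_val_sub_zero a b hab) =
      fuw 0 (u * Equiv.swap a b) 1 := by
  have h := fuw_mul_affineSwap 0 u 1 hab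
  rw [fuw_mul_swap_swap 0 u 1 (by simp [SameBlock])] at h
  exact h

theorem fuw_zero_one_apply (u : Equiv.Perm (Fin n)) (a : Fin n) :
    (fuw 0 u 1).1 ((a.val : ℤ) + 1) = (u a).val + 1 := by
  have := fuw_apply_zero 0 u 1 a
  simpa [omega] using this

theorem permLength_lt_mul_swap (u : Equiv.Perm (Fin n)) {a b : Fin n} (hab : a < b)
    (hu : u a < u b) : permLength u + 1 ≤ permLength (u * Equiv.swap a b) := by
  rw [← affineLength_fuw_zero_one, ← affineLength_fuw_zero_one, ← fuw_zero_mul_affineSwap u hab.ne]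
  apply affineLength_lt_mul_affineSwap
  · rw [Fin.lt_def] at hab; omega
  · rw [fuw_zero_one_apply, fuw_zero_one_apply]
    rw [Fin.lt_def] at hu; omega

theorem permLength_mul_swap_of_cover (u : Equiv.Perm (Fin n)) {a b : Fin n} (hab : a < b)
    (hu : u a < u b) (hcov : ∀ c, a < c → c < b → u a < u c → ¬ u c < u b) :
    permLength (u * Equiv.swap a b) = permLength u + 1 := by
  rw [← affineLength_fuw_zero_one, ← affineLength_fuw_zero_one, ← fuw_zero_mul_affineSwap u hab.ne]
  have hab' := Fin.lt_def.1 hab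
  have hu' := Fin.lt_def.1 hu
  apply affineLength_mul_affineSwap_of_cover
  · omega
  · rw [fuw_zero_one_apply, fuw_zero_one_apply]; omega
  · have := b.isLt; omega
  · intro p h1 h2
    obtain ⟨c, rfl⟩ : ∃ c : Fin n, p = (c.val : ℤ) + 1 :=
      ⟨⟨(p - 1).toNat, by have := b.isLt; omega⟩, by simp only; omega⟩
    rw [fuw_zero_one_apply, fuw_zero_one_apply, fuw_zero_one_apply]
    intro h3 h4
    exact hcov c (Fin.lt_def.2 (by omega)) (Fin.lt_def.2 (by omega)) (Fin.lt_def.2 (by omega))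
      (Fin.lt_def.2 (by omega))

/-! ### Bruhat order and covers -/

theorem bruhatLE_mul_swap (u : Equiv.Perm (Fin n)) {a b : Fin n} (hab : a < b) (hu : u a < u b) :
    BruhatLE u (u * Equiv.swap a b) :=
  Relation.ReflTransGen.single ⟨_, ⟨a, b, hab.ne, rfl⟩, rfl, permLength_lt_mul_swap u hab hu⟩

theorem exists_swap_of_isSwap {u t : Equiv.Perm (Fin n)} (ht : t.IsSwap)
    (hl : permLength u < permLength (u * t)) :
    ∃ a b, a < b ∧ u a < u b ∧ t = Equiv.swap a b := by
  have aux : ∀ a b : Fin n, a < b → t = Equiv.swap a b → u a < u b := by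
    rintro a b hab rfl
    by_contra hc
    have hlt : u b < u a := lt_of_le_of_ne (not_lt.1 hc) (u.injective.ne hab.ne')
    have := permLength_lt_mul_swap (u * Equiv.swap a b) hab (by simpa using hlt)
    rw [mul_assoc, Equiv.swap_mul_self, mul_one] at this
    omega
  obtain ⟨a, b, hab, rfl⟩ := ht
  rcases lt_or_gt_of_ne hab with h | h
  · exact ⟨a, b, h, aux a b h rfl, rfl⟩
  · exact ⟨b, a, h, aux b a h (Equiv.swap_comm a b), Equiv.swap_comm a b⟩

theorem BruhatLE.eq_or_permLength_lt {u v : Equiv.Perm (Fin n)} (h : BruhatLE u v) :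
    u = v ∨ permLength u < permLength v := by
  induction h with
  | refl => exact Or.inl rfl
  | tail _ hs ih =>
    obtain ⟨t, -, -, hl⟩ := hs
    right
    rcases ih with rfl | ih
    · exact hl
    · exact ih.trans hl

theorem bruhatCovers_of_permLength {u w : Equiv.Perm (Fin n)} (h : BruhatLE u w)
    (hl : permLength w = permLength u + 1) : BruhatCovers u w := by
  refine ⟨h, by rintro rfl; omega, fun v h1 h2 => ?_⟩
  rcases h1.eq_or_permLength_lt with rfl | h3
  · exact Or.inl rfl
  rcases h2.eq_or_permLength_lt with rfl | h4
  · exact Or.inr rfl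
  omega

/-- A position $c$ between $a$ and $b$ with an intermediate value would refine the cover to the
chain $u<u(ac)<u(ac)(ab)<u(ac)(ab)(cb)=u(ab)$. -/
theorem BruhatCovers.exists_swap {u w : Equiv.Perm (Fin n)} (h : BruhatCovers u w) :
    ∃ a b, a < b ∧ u a < u b ∧ w = u * Equiv.swap a b ∧
      ∀ c, a < c → c < b → u a < u c → ¬ u c < u b := by
  obtain ⟨hle, hne, hcov⟩ := h
  rcases Relation.ReflTransGen.cases_head hle with rfl | ⟨v, ⟨t, ht, rfl, hl⟩, hvw⟩
  · exact absurd rfl hne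
  have hw : u * t = w := by
    rcases hcov _ (Relation.ReflTransGen.single ⟨t, ht, rfl, hl⟩) hvw with h | h
    · rw [h] at hl; omega
    · exact h
  obtain ⟨a, b, hab, hu, rfl⟩ := exists_swap_of_isSwap ht hl
  refine ⟨a, b, hab, hu, hw.symm, fun c hac hcb h1 h2 => ?_⟩
  subst hw
  have e1 : (u * Equiv.swap a c) a = u c := by simp
  have e2 : (u * Equiv.swap a c) b = u b := by
    rw [Equiv.Perm.mul_apply, Equiv.swap_apply_of_ne_of_ne hab.ne' hcb.ne']
  have e3 : (u * Equiv.swap a c) c = u a := by simp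
  have e4 : (u * Equiv.swap a c * Equiv.swap a b) c = u a := by
    rw [Equiv.Perm.mul_apply, Equiv.swap_apply_of_ne_of_ne hac.ne' hcb.ne, e3]
  have e5 : (u * Equiv.swap a c * Equiv.swap a b) b = u c := by
    rw [Equiv.Perm.mul_apply, Equiv.swap_apply_right, e1]
  have e6 : u * Equiv.swap a c * Equiv.swap a b * Equiv.swap c b = u * Equiv.swap a b := by
    ext x
    simp only [Equiv.Perm.mul_apply]
    congr 2
    simp only [Equiv.swap_apply_def]
    have := hac.ne
    have := hcb.ne
    have := hab.ne
    split_ifs <;> simp_all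
  have s1 := bruhatLE_mul_swap u hac h1
  have s2 := bruhatLE_mul_swap (u * Equiv.swap a c) hab (by rw [e1, e2]; exact h2)
  have s3 := bruhatLE_mul_swap (u * Equiv.swap a c * Equiv.swap a b) hcb (by rw [e4, e5]; exact h1)
  rw [e6] at s3
  rcases hcov _ s1 (s2.trans s3) with h | h
  · have := permLength_lt_mul_swap u hac h1
    rw [h] at this; omega
  · have := DFunLike.congr_fun h b
    rw [e2] at this
    simp only [Equiv.Perm.mul_apply, Equiv.swap_apply_right] at this
    exact hu.ne' this

theorem mem_sigma {k : ℕ} {w : Equiv.Perm (Fin n)} {a : Fin n} :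
    w a ∈ sigma k w ↔ a.val < k := by
  simp [sigma]

theorem sigma_mul_swap_of_sameBlock {k : ℕ} (w : Equiv.Perm (Fin n)) {a b : Fin n}
    (h : SameBlock k a b) : sigma k (w * Equiv.swap a b) = sigma k w := by
  ext x
  obtain ⟨c, rfl⟩ := w.surjective x
  rw [mem_sigma, show w c = (w * Equiv.swap a b) (Equiv.swap a b c) by simp, mem_sigma]
  exact inParabolic_swap h c

theorem sigma_ne_sigma_mul_swap {k : ℕ} (w : Equiv.Perm (Fin n)) {a b : Fin n}
    (ha : a.val < k) (hb : ¬ b.val < k) : sigma k w ≠ sigma k (w * Equiv.swap a b) := by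
  intro h
  have h1 : w a ∈ sigma k w := mem_sigma.2 ha
  rw [h, show w a = (w * Equiv.swap a b) b by simp, mem_sigma] at h1
  exact hb h1

/-! ### The criterion for the `k`-Bruhat order -/

/-- The Bergeron–Sottile criterion for `u ≤_k w`. -/
structure KCriterion (k : ℕ) (u w : Equiv.Perm (Fin n)) : Prop where
  le : ∀ a : Fin n, a.val < k → u a ≤ w a
  ge : ∀ a : Fin n, ¬ a.val < k → w a ≤ u a
  cross : ∀ a b : Fin n, a < b → u a < u b → w b < w a → a.val < k ∧ ¬ b.val < k

theorem KCriterion.blockDefect {k : ℕ} {u w : Equiv.Perm (Fin n)} (h : KCriterion k u w) :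
    blockDefect k u w = 0 := by
  rw [BoundedAffine.blockDefect, Finset.card_eq_zero, Finset.filter_eq_empty_iff]
  rintro p - ⟨h1, h2, h3, h4⟩
  have := h.cross _ _ h1 h3 h4
  exact this.2 (h2.1 this.1)

theorem KCriterion.of_blockDefect {k : ℕ} {u w : Equiv.Perm (Fin n)}
    (h1 : ∀ a : Fin n, a.val < k → u a ≤ w a) (h2 : ∀ a : Fin n, ¬ a.val < k → w a ≤ u a)
    (h3 : BoundedAffine.blockDefect k u w = 0) : KCriterion k u w := by
  refine ⟨h1, h2, fun a b hab hu hw => ?_⟩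
  rw [BoundedAffine.blockDefect, Finset.card_eq_zero, Finset.filter_eq_empty_iff] at h3
  have := h3 (Finset.mem_univ (a, b))
  simp only [SameBlock, not_and] at this
  rw [Fin.lt_def] at hab
  by_contra hc
  exact this hab (by omega) hu hw

theorem KCriterion.refl (k : ℕ) (u : Equiv.Perm (Fin n)) : KCriterion k u u :=
  ⟨fun _ _ => le_rfl, fun _ _ => le_rfl, fun _ _ _ h1 h2 => absurd h1 (lt_asymm h2)⟩

/-- A cover that changes `sigma` exchanges some $a\le k<b$, raising the value at $a$ and lowering
that at $b$. It cannot create a forbidden pair in one block or a pair ordered the other way: one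
involving $a$ or $b$ would supply an intermediate point of the cover. -/
theorem KBruhatLE.kCriterion {k : ℕ} {u w : Equiv.Perm (Fin n)} (h : KBruhatLE k u w) :
    KCriterion k u w := by
  induction h with
  | refl => exact KCriterion.refl k u
  | @tail w v _ hs ih =>
    obtain ⟨hc, hσ⟩ := hs
    obtain ⟨a, b, hab, hw, rfl, hcov⟩ := hc.exists_swap
    have hblock : a.val < k ∧ ¬ b.val < k := by
      rw [Fin.lt_def] at hab
      by_contra h
      exact hσ (sigma_mul_swap_of_sameBlock w (by unfold SameBlock; omega)).symm
    obtain ⟨ha, hb⟩ := hblock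
    clear hc hσ
    have ea : (w * Equiv.swap a b) a = w b := by simp
    have eb : (w * Equiv.swap a b) b = w a := by simp
    have ec : ∀ c, c ≠ a → c ≠ b → (w * Equiv.swap a b) c = w c := fun c h1 h2 => by
      rw [Equiv.Perm.mul_apply, Equiv.swap_apply_of_ne_of_ne h1 h2]
    refine ⟨fun c hc => ?_, fun c hc => ?_, fun c d hcd hu hw' => ?_⟩
    · by_cases hca : c = a
      · subst hca; rw [ea]; exact (ih.le _ hc).trans hw.le
      · rw [ec c hca (by rintro rfl; exact hb hc)]; exact ih.le _ hc
    · by_cases hcb : c = b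
      · subst hcb; rw [eb]; exact hw.le.trans (ih.ge _ hc)
      · rw [ec c (by rintro rfl; exact hc ha) hcb]; exact ih.ge _ hc
    · by_contra hcon
      have hcd' := Fin.lt_def.1 hcd
      have hab' := Fin.lt_def.1 hab
      have hord : ∀ c d : Fin n, c < d → u c < u d → ¬ (c.val < k ∧ ¬ d.val < k) → w c < w d := by
        intro c d h1 h2 h3
        by_contra h4
        exact h3 (ih.cross c d h1 h2 (lt_of_le_of_ne (not_lt.1 h4) (w.injective.ne h1.ne')))
      have h0 := hord c d hcd hu hcon
      by_cases hc : c.val < k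
      · have hd : d.val < k := by by_contra hd; exact hcon ⟨hc, hd⟩
        have hcb : c ≠ b := by rintro rfl; exact hb hc
        have hdb : d ≠ b := by rintro rfl; exact hb hd
        by_cases hca : c = a
        · subst hca
          rw [ea, ec d hcd.ne' hdb] at hw'
          exact hcov d hcd (Fin.lt_def.2 (by omega)) h0 hw'
        · rw [ec c hca hcb] at hw'
          by_cases hda : d = a
          · subst hda; rw [ea] at hw'; exact lt_asymm (hw'.trans h0) hw
          · rw [ec d hda hdb] at hw'; exact lt_asymm h0 hw'
      · have hd : ¬ d.val < k := by omega
        have hca : c ≠ a := by rintro rfl; exact hc ha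
        have hda : d ≠ a := by rintro rfl; exact hd ha
        by_cases hdb : d = b
        · subst hdb
          rw [eb, ec c hca hcd.ne] at hw'
          exact hcov c (Fin.lt_def.2 (by omega)) hcd hw' h0
        · rw [ec d hda hdb] at hw'
          by_cases hcb : c = b
          · subst hcb; rw [eb] at hw'; exact lt_asymm (h0.trans hw') hw
          · rw [ec c hca hcb] at hw'; exact lt_asymm h0 hw'

theorem KCriterion.bounded {k : ℕ} {u w : Equiv.Perm (Fin n)} (h : KCriterion k u w) (i : ℤ) :
    i ≤ (fuw k u w).1 i ∧ (fuw k u w).1 i ≤ i + n := by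
  obtain ⟨q, a, rfl⟩ := exists_eq_window w i
  rw [fuw_apply, add_mul]
  have h1 := (u a).isLt
  have h2 := (w a).isLt
  rcases omega_cases k a with ⟨h3, h4⟩ | ⟨h3, h4⟩ <;> rw [h4]
  · have := Fin.le_def.1 (h.le a h3); omega
  · have := Fin.le_def.1 (h.ge a h3); omega

theorem le_and_ge_of_bounded {k : ℕ} {u w : Equiv.Perm (Fin n)}
    (h : ∀ i, i ≤ (fuw k u w).1 i ∧ (fuw k u w).1 i ≤ i + n) :
    (∀ a : Fin n, a.val < k → u a ≤ w a) ∧ (∀ a : Fin n, ¬ a.val < k → w a ≤ u a) := by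
  constructor <;> intro a ha <;> have h1 := h (((w a).val : ℤ) + 1) <;>
    rw [fuw_apply_zero] at h1 <;> rw [Fin.le_def] <;> simp only [omega, ha, if_true, if_false] at h1 <;>
    omega

/-- Otherwise $w\le u$ pointwise, and equality of the sums of all values forces $u=w$. -/
theorem KCriterion.exists_lt {k : ℕ} {u w : Equiv.Perm (Fin n)} (h : KCriterion k u w)
    (hne : u ≠ w) : ∃ a : Fin n, a.val < k ∧ u a < w a := by
  by_contra! hc
  apply hne
  have hle : ∀ a ∈ Finset.univ, (w a).val ≤ (u a).val := by
    intro a _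
    by_cases ha : a.val < k
    · exact hc a ha
    · exact h.ge a ha
  have hs : ∑ a, (w a).val = ∑ a, (u a).val := by
    rw [Equiv.sum_comp w (fun a => a.val), Equiv.sum_comp u (fun a => a.val)]
  ext a
  exact ((Finset.sum_eq_sum_iff_of_le hle).1 hs a (Finset.mem_univ a)).symm

/-- The greedy step towards $w$: choose $a\le k$ not yet at its final value with $u(a)$ largest,
then $b>k$ not yet final with $u(b)$ smallest in $(u(a),w(a)]$. The extremal choices make
$f_{u,w}\to f_{u(ab),w}$ a step of length exactly one, and the length formula does the rest. -/
theorem KCriterion.exists_cover {k : ℕ} (hk : k ≤ n) {u w : Equiv.Perm (Fin n)}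
    (h : KCriterion k u w) (hne : u ≠ w) :
    ∃ a b : Fin n, a.val < k ∧ ¬ b.val < k ∧ u a < u b ∧
      permLength (u * Equiv.swap a b) = permLength u + 1 ∧ KCriterion k (u * Equiv.swap a b) w := by
  obtain ⟨a₀, ha₀⟩ := h.exists_lt hne
  obtain ⟨a, ha, hamax⟩ := Finset.exists_max_image
    (Finset.univ.filter fun a : Fin n => a.val < k ∧ u a < w a) u ⟨a₀, by simpa using ha₀⟩
  simp only [Finset.mem_filter, Finset.mem_univ, true_and] at ha hamax
  obtain ⟨hak, haw⟩ := ha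
  have hfix : ∀ c : Fin n, c.val < k → u a < u c → u c = w c := by
    intro c hc hlt
    by_contra hcon
    exact absurd (hamax c ⟨hc, lt_of_le_of_ne (h.le c hc) hcon⟩) (not_le.2 hlt)
  -- The position where $u$ takes the value $w(a)$ is an admissible candidate for $b$.
  obtain ⟨c₀, hc₀⟩ := u.surjective (w a)
  have hc₀k : ¬ c₀.val < k := by
    intro hc
    have h1 := hfix c₀ hc (by rw [hc₀]; exact haw)
    rw [hc₀] at h1
    have h2 := w.injective h1
    rw [← h2] at hc₀
    exact haw.ne hc₀
  have hc₀w : w c₀ < u c₀ := by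
    refine lt_of_le_of_ne (h.ge c₀ hc₀k) ?_
    rw [hc₀]
    intro h1
    exact hc₀k (by rw [w.injective h1]; exact hak)
  obtain ⟨b, hb, hbmin⟩ := Finset.exists_min_image
    (Finset.univ.filter fun b : Fin n => ¬ b.val < k ∧ u a < u b ∧ u b ≤ w a ∧ w b < u b) u
    ⟨c₀, by simp only [Finset.mem_filter, Finset.mem_univ, true_and]
            exact ⟨hc₀k, by rw [hc₀]; exact haw, hc₀.le, hc₀w⟩⟩
  simp only [Finset.mem_filter, Finset.mem_univ, true_and] at hb hbmin
  obtain ⟨hbk, hab, hbw, hbu⟩ := hb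
  have hab_ne : a ≠ b := by rintro rfl; exact hbk hak
  -- If $w(b)>u(a)$, the position $d$ with $u(d)=w(b)$ is either fixed in the first block, so $d=b$,
  -- or a smaller candidate for $b$.
  have hba : w b ≤ u a := by
    by_contra hc
    rw [not_le] at hc
    obtain ⟨d, hd⟩ := u.surjective (w b)
    by_cases hdk : d.val < k
    · have h1 := hfix d hdk (by rw [hd]; exact hc)
      rw [hd] at h1
      exact hbk (by rw [w.injective h1]; exact hdk)
    · have h1 : w d ≠ u d := by
        rw [hd]; intro h2
        rw [w.injective h2] at hd
        exact hbu.ne hd.symm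
      have := hbmin d ⟨hdk, by rw [hd]; exact hc, by rw [hd]; exact (hbu.trans_le hbw).le,
        lt_of_le_of_ne (h.ge d hdk) h1⟩
      rw [hd] at this
      exact absurd this (not_le.2 hbu)
  have hnd := not_dvd_val_sub _ _ (w.injective.ne hab_ne) 1
  have f1 : (fuw k u w).1 (((w a).val : ℤ) + 1) = n + (u a).val + 1 := by
    rw [fuw_apply_zero]; simp [omega, hak]
  have f2 : (fuw k u w).1 (((w b).val : ℤ) + 1 + 1 * n) = n + (u b).val + 1 := by
    rw [affine_apply_add_mul, fuw_apply_zero]; simp [omega, hbk]; ring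
  have hlen : affineLength (fuw k (u * Equiv.swap a b) w) = affineLength (fuw k u w) + 1 := by
    rw [← fuw_mul_affineSwap_shift k u w hab_ne hak hbk]
    have hwa := (w a).isLt
    simp only [Fin.lt_def, Fin.le_def] at haw hab hbw hbu hba
    apply affineLength_mul_affineSwap_of_cover
    · omega
    · rw [f1, f2]; omega
    · omega
    · intro p h1 h2 h3 h4
      obtain ⟨q, c, rfl⟩ := exists_eq_window w p
      rw [f1, fuw_apply] at h3
      rw [f2, fuw_apply] at h4
      have hwc := (w c).isLt
      have huc := (u c).isLt
      have hn : (0 : ℤ) < n := by omega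
      have hq1 : (-1) * (n : ℤ) < q * n := by omega
      have hq2 : q * (n : ℤ) < 2 * n := by omega
      have hq1' := lt_of_mul_lt_mul_right hq1 hn.le
      have hq2' := lt_of_mul_lt_mul_right hq2 hn.le
      have hq : q = 0 ∨ q = 1 := by omega
      rcases omega_cases k c with ⟨hc, hc'⟩ | ⟨hc, hc'⟩ <;> rw [hc'] at h3 h4 <;>
        rcases hq with rfl | rfl
      -- Shift $0$, $c\le k$: maximality of $u(a)$ gives $w(c)=u(c)<u(b)\le w(a)$, so the position
      -- is not to the right of $w(a)$.
      · have := hfix c hc (Fin.lt_def.2 (by omega))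
        rw [Fin.ext_iff] at this
        omega
      · omega
      · omega
      -- Shift $1$, $c>k$: here $w(c)<w(b)\le u(a)<u(c)<u(b)$, so $c$ would beat $b$.
      · have hm := hbmin c ⟨hc, Fin.lt_def.2 (by omega), Fin.le_def.2 (by omega),
          Fin.lt_def.2 (by omega)⟩
        rw [Fin.le_def] at hm
        omega
  have hlt : a < b := Fin.lt_def.2 (by omega)
  have hl1 := permLength_lt_mul_swap u hlt hab
  have hl2 := affineLength_fuw hk u w
  have hl3 := affineLength_fuw hk (u * Equiv.swap a b) w
  rw [hlen] at hl3
  rw [h.blockDefect] at hl2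
  push_cast at hl2 hl3
  -- The two length formulas give $\ell(u)+1=\ell(u(ab))+2d$, while $\ell(u(ab))\ge\ell(u)+1$. Hence
  -- equality holds and $d=0$.
  refine ⟨a, b, hak, hbk, hab, by omega, KCriterion.of_blockDefect ?_ ?_ (by omega)⟩
  · intro c hc
    by_cases hca : c = a
    · subst hca; simpa using hbw
    · rw [Equiv.Perm.mul_apply, Equiv.swap_apply_of_ne_of_ne hca (by rintro rfl; exact hbk hc)]
      exact h.le c hc
  · intro c hc
    by_cases hcb : c = b
    · subst hcb; simpa using hba
    · rw [Equiv.Perm.mul_apply, Equiv.swap_apply_of_ne_of_ne (by rintro rfl; exact hc hak) hcb]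
      exact h.ge c hc

theorem permLength_le (u : Equiv.Perm (Fin n)) : permLength u ≤ n * n := by
  refine (Finset.card_filter_le _ _).trans ?_
  simp

theorem KCriterion.kBruhatLE {k : ℕ} (hk : k ≤ n) {u w : Equiv.Perm (Fin n)}
    (h : KCriterion k u w) : KBruhatLE k u w := by
  induction hm : n * n - permLength u using Nat.strong_induction_on generalizing u with
  | _ m ih =>
    by_cases hne : u = w
    · subst hne; exact Relation.ReflTransGen.refl
    obtain ⟨a, b, ha, hb, hab, hl, h'⟩ := h.exists_cover hk hne
    have hlt : a < b := Fin.lt_def.2 (by omega)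
    have := permLength_le (u * Equiv.swap a b)
    refine Relation.ReflTransGen.head ?_ (ih _ (by omega) h' rfl)
    exact ⟨bruhatCovers_of_permLength (bruhatLE_mul_swap u hlt hab) hl,
      sigma_ne_sigma_mul_swap u ha hb⟩

end Finite

/-! ### Bounded affine permutations -/

section Bounded

variable {n : ℕ} [NeZero n]

theorem sum_Ioc_window {M : Type*} [AddCommMonoid M] (g : ℤ → M) :
    ∑ i ∈ Finset.Ioc (0 : ℤ) n, g i = ∑ a : Fin n, g ((a.val : ℤ) + 1) := by
  symm
  refine Finset.sum_nbij (fun a => (a.val : ℤ) + 1) ?_ ?_ ?_ ?_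
  · intro a _
    have := a.isLt
    rw [Finset.mem_Ioc]; omega
  · intro a _ b _ h
    ext
    have h : (a.val : ℤ) + 1 = b.val + 1 := h
    omega
  · intro i hi
    have hi := Finset.mem_Ioc.1 (Finset.mem_coe.1 hi)
    exact ⟨⟨(i - 1).toNat, by omega⟩, by simp, by simp only; omega⟩
  · intros; rfl

theorem sum_Ioc_periodic {g : ℤ → ℤ} (hg : ∀ i, g (i + n) = g i) (q : ℤ) :
    ∑ i ∈ Finset.Ioc (q - n) q, g i = ∑ i ∈ Finset.Ioc (0 : ℤ) n, g i := by
  have hn : (0 : ℤ) < n := by exact_mod_cast NeZero.pos n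
  have step : ∀ q : ℤ, ∑ i ∈ Finset.Ioc (q + 1 - n) (q + 1), g i =
      ∑ i ∈ Finset.Ioc (q - n) q, g i := by
    intro q
    have h1 : insert (q + 1) (Finset.Ioc (q - n) q) =
        insert (q + 1 - n) (Finset.Ioc (q + 1 - n) (q + 1)) := by
      ext x; simp only [Finset.mem_insert, Finset.mem_Ioc]; omega
    have h2 := congrArg (fun s => ∑ i ∈ s, g i) h1
    rw [Finset.sum_insert (by simp), Finset.sum_insert (by simp)] at h2
    have h3 := hg (q + 1 - n)
    rw [sub_add_cancel] at h3
    linarith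
  have all : ∀ q : ℤ, ∑ i ∈ Finset.Ioc (q - n) q, g i = ∑ i ∈ Finset.Ioc ((0 : ℤ) - n) 0, g i := by
    intro q
    induction q using Int.induction_on with
    | zero => rfl
    | succ q ih => rw [step, ih]
    | pred q ih =>
      rw [← ih, ← step (-(q : ℤ) - 1)]
      congr 2 <;> ring
  rw [all q, ← all n, sub_self]

theorem mem_affinePermOfBall_iff {k : ℕ} {f : AffinePerm n} :
    f ∈ AffinePermOfBall k n ↔ ∑ i ∈ Finset.Ioc (0 : ℤ) n, (f.1 i - i) = n * k := by
  have hn : (n : ℚ) ≠ 0 := by exact_mod_cast NeZero.ne n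
  have hI : Finset.Icc (1 : ℤ) n = Finset.Ioc (0 : ℤ) n := by
    ext; simp only [Finset.mem_Icc, Finset.mem_Ioc]; omega
  change ballNumber f = k ↔ _
  rw [ballNumber, hI, ← Int.cast_sum, one_div, inv_mul_eq_iff_eq_mul₀ hn]
  norm_cast

/-- Subtracting $n$ from the values exceeding $q$ turns $f$ into a permutation of the window
$(q-n,q]$. So $\sum(f(s)-s)=nk$ is $n$ times the number of such values. -/
theorem card_window_gt {k : ℕ} {f : AffinePerm n} (hf : f ∈ Bound k n) (q : ℤ) :
    ((Finset.Ioc (q - n) q).filter fun s => q < f.1 s).card = k := by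
  have hn : (0 : ℤ) < n := by exact_mod_cast NeZero.pos n
  have h1 : ∑ s ∈ Finset.Ioc (q - n) q, (f.1 s - s) = n * k := by
    rw [sum_Ioc_periodic (fun i => ?_), mem_affinePermOfBall_iff.1 hf.1]
    have := affine_apply_add_mul f i 1
    rw [one_mul] at this
    rw [this]; ring
  have hmap : Set.MapsTo (fun s => if q < f.1 s then f.1 s - n else f.1 s)
      (Finset.Ioc (q - n) q : Finset ℤ) (Finset.Ioc (q - n) q : Finset ℤ) := by
    intro s hs
    have hs := Finset.mem_Ioc.1 (Finset.mem_coe.1 hs)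
    have := hf.2 s
    simp only [Finset.coe_Ioc, Set.mem_Ioc]
    split_ifs <;> omega
  have hinj : Set.InjOn (fun s => if q < f.1 s then f.1 s - n else f.1 s)
      (Finset.Ioc (q - n) q : Finset ℤ) := by
    intro s hs t ht hst
    have hs := Finset.mem_Ioc.1 (Finset.mem_coe.1 hs)
    have ht := Finset.mem_Ioc.1 (Finset.mem_coe.1 ht)
    have key : ∀ a b : ℤ, f.1 a = f.1 b + n → a = b + n := by
      intro a b hab
      apply f.1.injective
      have := affine_apply_add_mul f b 1
      rw [one_mul] at this
      rw [this, hab]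
    simp only at hst
    split_ifs at hst with h2 h3 h3
    · exact f.1.injective (by linarith)
    · have := key s t (by linarith); omega
    · have := key t s (by linarith); omega
    · exact f.1.injective hst
  have h2 : ∑ s ∈ Finset.Ioc (q - n) q, (if q < f.1 s then f.1 s - n else f.1 s) =
      ∑ s ∈ Finset.Ioc (q - n) q, s := by
    have himg : (Finset.Ioc (q - n) q).image (fun s => if q < f.1 s then f.1 s - n else f.1 s) =
        Finset.Ioc (q - n) q :=
      Finset.eq_of_subset_of_card_le (Finset.image_subset_iff.2 hmap)
        (Finset.card_image_of_injOn hinj).ge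
    conv_rhs => rw [← himg]
    rw [Finset.sum_image hinj]
  have h3 : ∑ s ∈ Finset.Ioc (q - n) q, (f.1 s - s) = ∑ s ∈ Finset.Ioc (q - n) q,
      ((if q < f.1 s then f.1 s - n else f.1 s) - s + n * (if q < f.1 s then 1 else 0)) := by
    refine Finset.sum_congr rfl fun s _ => ?_
    split_ifs <;> ring
  rw [h3, Finset.sum_add_distrib, Finset.sum_sub_distrib, h2, sub_self, zero_add,
    ← Finset.mul_sum] at h1
  have h4 := mul_left_cancel₀ hn.ne' h1
  rw [Finset.card_filter]
  exact_mod_cast h4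

theorem KCriterion.fuw_mem_bound {k : ℕ} (hk : k ≤ n) {u w : Equiv.Perm (Fin n)}
    (h : KCriterion k u w) : fuw k u w ∈ Bound k n := by
  refine ⟨mem_affinePermOfBall_iff.2 ?_, h.bounded⟩
  rw [sum_Ioc_window, ← Equiv.sum_comp w]
  simp only [fuw_apply_zero]
  have h1 : ∑ a, ((u a).val : ℤ) = ∑ a, ((w a).val : ℤ) := by
    rw [Equiv.sum_comp u (fun a => (a.val : ℤ)), Equiv.sum_comp w (fun a => (a.val : ℤ))]
  have h2 : ∑ a, omega k n a = k := by
    simp only [omega]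
    rw [Finset.sum_boole, Fin.card_filter_val_lt, min_eq_right hk]
  have h3 : ∀ a, omega k n a * n + ((u a).val : ℤ) + 1 - ((w a).val + 1) =
      n * omega k n a + ((u a).val - (w a).val) := fun a => by ring
  simp only [h3]
  rw [Finset.sum_add_distrib, Finset.sum_sub_distrib, h1, sub_self, add_zero, ← Finset.mul_sum, h2]

/-- `w` is increasing on each of the two blocks of positions. -/
def Grassmannian (k : ℕ) (w : Equiv.Perm (Fin n)) : Prop :=
  ∀ a b : Fin n, a < b → SameBlock k a b → w a < w b

theorem exists_grassmannian {k : ℕ} (hk : k ≤ n) (S : Finset (Fin n)) (hS : S.card = k) :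
    ∃ w : Equiv.Perm (Fin n), Grassmannian k w ∧ ∀ a, w a ∈ S ↔ a.val < k := by
  have hSc : Sᶜ.card = n - k := by rw [Finset.card_compl, Fintype.card_fin, hS]
  let w₀ : Fin n → Fin n := fun a =>
    if h : a.val < k then S.orderEmbOfFin hS ⟨a.val, h⟩
    else Sᶜ.orderEmbOfFin hSc ⟨a.val - k, by have := a.isLt; omega⟩
  have hpos : ∀ a : Fin n, (h : a.val < k) → w₀ a = S.orderEmbOfFin hS ⟨a.val, h⟩ :=
    fun a h => dif_pos h
  have hneg : ∀ a : Fin n, (h : ¬ a.val < k) →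
      w₀ a = Sᶜ.orderEmbOfFin hSc ⟨a.val - k, by have := a.isLt; omega⟩ := fun a h => dif_neg h
  have hmem : ∀ a, w₀ a ∈ S ↔ a.val < k := by
    intro a
    by_cases h : a.val < k
    · rw [hpos a h]; simp only [h, iff_true]; exact Finset.orderEmbOfFin_mem _ _ _
    · rw [hneg a h]; simp only [h, iff_false]
      exact Finset.mem_compl.1 (Finset.orderEmbOfFin_mem _ _ _)
  have hmono : ∀ a b : Fin n, a < b → SameBlock k a b → w₀ a < w₀ b := by
    intro a b hab hs
    have hab' := Fin.lt_def.1 hab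
    by_cases h : a.val < k
    · rw [hpos a h, hpos b (hs.1 h)]
      exact (Finset.orderEmbOfFin S hS).strictMono (Fin.lt_def.2 hab')
    · have hb : ¬ b.val < k := fun hb => h (hs.2 hb)
      rw [hneg a h, hneg b hb]
      exact (Finset.orderEmbOfFin Sᶜ hSc).strictMono (Fin.lt_def.2 (by simp only; omega))
  have hinj : Function.Injective w₀ := by
    intro a b hab
    have hs : SameBlock k a b := by
      unfold SameBlock; rw [← hmem a, ← hmem b, hab]
    by_contra hne
    rcases lt_or_gt_of_ne hne with h | h
    · exact (hmono a b h hs).ne hab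
    · exact (hmono b a h hs.symm).ne hab.symm
  exact ⟨Equiv.ofBijective w₀ (Finite.injective_iff_bijective.1 hinj), hmono, hmem⟩

/-- Take $w(\{1,\dots,k\})$ to be the set of $c\in[n]$ with $f(c)>n$, and let $u$ record the
residues of the values. The crossing condition is automatic, as a Grassmannian $w$ has inversions
only between the two blocks. -/
theorem exists_fuw_eq {k : ℕ} (hk : k ≤ n) {f : AffinePerm n} (hf : f ∈ Bound k n) :
    ∃ u w : Equiv.Perm (Fin n), KCriterion k u w ∧ Grassmannian k w ∧ fuw k u w = f := by
  have hcard : (Finset.univ.filter fun a : Fin n => (n : ℤ) < f.1 ((a.val : ℤ) + 1)).card = k := by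
    rw [← card_window_gt hf n, sub_self, Finset.card_filter, Finset.card_filter, sum_Ioc_window]
  obtain ⟨w, hw, hS⟩ := exists_grassmannian hk _ hcard
  simp only [Finset.mem_filter, Finset.mem_univ, true_and] at hS
  let u₀ : Fin n → Fin n := fun a => (window n (f.1 (((w a).val : ℤ) + 1))).2
  have hu₀ : ∀ a, f.1 (((w a).val : ℤ) + 1) = omega k n a * n + ((u₀ a).val : ℤ) + 1 := by
    intro a
    obtain ⟨q, b, hqb⟩ := exists_eq_window (1 : Equiv.Perm (Fin n)) (f.1 (((w a).val : ℤ) + 1))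
    rw [Equiv.Perm.one_apply] at hqb
    have hu : u₀ a = b := by simp only [u₀]; rw [hqb, window_apply]
    have h1 := hf.2 (((w a).val : ℤ) + 1)
    have h2 := (w a).isLt
    have h3 := b.isLt
    have h4 := hS a
    rw [hqb] at h1 h4
    have hn : (0 : ℤ) < n := by omega
    have hq1 : (-1) * (n : ℤ) < q * n := by omega
    have hq2 : q * (n : ℤ) < 2 * n := by omega
    have hq1' := lt_of_mul_lt_mul_right hq1 hn.le
    have hq2' := lt_of_mul_lt_mul_right hq2 hn.le
    rw [hqb, hu]
    obtain rfl | rfl : q = 0 ∨ q = 1 := by omega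
    · have : ¬ a.val < k := by rw [← h4]; omega
      simp [omega, this]
    · have : a.val < k := by rw [← h4]; omega
      simp [omega, this]
  have hinj : Function.Injective u₀ := by
    intro a b hab
    by_contra hne
    refine not_dvd_val_sub_zero (w a) (w b) (w.injective.ne hne)
      ((dvd_affine_apply_sub_iff f _ _).1 ?_)
    rw [hu₀, hu₀, hab]
    exact ⟨omega k n b - omega k n a, by ring⟩
  let u := Equiv.ofBijective u₀ (Finite.injective_iff_bijective.1 hinj)
  have hfu : f = fuw k u w := eq_fuw_of_forall k u w f hu₀
  obtain ⟨h1, h2⟩ := le_and_ge_of_bounded (k := k) (u := u) (w := w) (by rw [← hfu]; exact hf.2)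
  refine ⟨u, w, ⟨h1, h2, fun a b hab _ hlt => ?_⟩, hw, hfu.symm⟩
  have hs : ¬ SameBlock k a b := fun hs => lt_asymm hlt (hw a b hab hs)
  unfold SameBlock at hs
  rw [Fin.lt_def] at hab
  omega

/-- The set of $c\in[n]$ with $f(c)>n$ determines the coset of $w$. Then $w^{-1}w'$ preserves the
blocks and is increasing, hence is the identity. -/
theorem eq_of_fuw_eq {k : ℕ} {u w u' w' : Equiv.Perm (Fin n)}
    (h : fuw k u w = fuw k u' w') (hw : Grassmannian k w) (hw' : Grassmannian k w') :
    u = u' ∧ w = w' := by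
  have hmem : ∀ (u w : Equiv.Perm (Fin n)) (c : Fin n),
      (n : ℤ) < (fuw k u w).1 ((c.val : ℤ) + 1) ↔ (w.symm c).val < k := by
    intro u w c
    obtain ⟨a, rfl⟩ := w.surjective c
    have := (u a).isLt
    rw [Equiv.symm_apply_apply, fuw_apply_zero]
    rcases omega_cases k a with ⟨h1, h2⟩ | ⟨h1, h2⟩ <;> rw [h2] <;> omega
  have hz : ∀ a, (w.symm (w' a)).val < k ↔ a.val < k := by
    intro a
    rw [← hmem u w, h, hmem, Equiv.symm_apply_apply]
  have hmono : StrictMono (fun a => w.symm (w' a)) := by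
    intro a b hab
    simp only
    by_cases hs : SameBlock k a b
    · have h1 := hw' a b hab hs
      by_contra hc
      rcases (not_lt.1 hc).eq_or_lt with heq | hlt
      · exact hab.ne' (w'.injective (w.symm.injective heq))
      · have := hw _ _ hlt (by unfold SameBlock; rw [hz, hz]; exact hs.symm)
        simp only [Equiv.apply_symm_apply] at this
        exact lt_asymm h1 this
    · have h1 := hz a
      have h2 := hz b
      unfold SameBlock at hs
      rw [Fin.lt_def] at hab ⊢
      omega
  have hid : ∀ a, w.symm (w' a) = a := by
    intro a
    let e : Fin n ≃o Fin n := hmono.orderIsoOfSurjective _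
      ((w.symm.surjective).comp w'.surjective)
    have : e = OrderIso.refl _ := Subsingleton.elim _ _
    exact DFunLike.congr_fun this a
  have hww : w = w' := by
    ext a
    have := hid a
    rw [Equiv.symm_apply_eq] at this
    rw [this]
  subst hww
  exact ⟨fuw_left_injective k u u' w h, rfl⟩

/-- The bounds survive because $i<j\le f(j)<f(i)\le i+n<j+n$. -/
theorem bounded_mul_affineSwap {f : AffinePerm n} (hf : ∀ i, i ≤ f.1 i ∧ f.1 i ≤ i + n) {i j : ℤ}
    (h : ¬ (n : ℤ) ∣ j - i) (hij : i < j) (hlt : f.1 j < f.1 i) (m : ℤ) :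
    m ≤ (f * affineSwap i j h).1 m ∧ (f * affineSwap i j h).1 m ≤ m + n := by
  change m ≤ f.1 ((affineSwap i j h).1 m) ∧ f.1 ((affineSwap i j h).1 m) ≤ m + n
  have h1 := hf i
  have h2 := hf j
  rcases affineSwap_cases i j m h with ⟨r, rfl, h3⟩ | ⟨r, rfl, h3⟩ | ⟨-, -, h3⟩
  · rw [h3, affine_apply_add_mul]; constructor <;> linarith
  · rw [h3, affine_apply_add_mul]; constructor <;> linarith
  · rw [h3]; exact hf m

/-- A Bruhat step `f < f t` exchanges positions `i < j` with `f i < f j`. -/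
theorem exists_affineSwap_of_step {f g t : AffinePerm n} (ht : IsAffineReflection t)
    (hg : g = f * t) (hl : affineLength f < affineLength g) :
    ∃ (i j : ℤ) (h : ¬ (n : ℤ) ∣ j - i), i < j ∧ f.1 i < f.1 j ∧ g = f * affineSwap i j h := by
  obtain ⟨i, j, h, hij, rfl⟩ := ht.exists_affineSwap
  refine ⟨i, j, h, hij, ?_, hg⟩
  by_contra hc
  have hne : f.1 i ≠ f.1 j := f.1.injective.ne hij.ne
  have hlt : f.1 j < f.1 i := lt_of_le_of_ne (not_lt.1 hc) hne.symm
  have hti : (affineSwap i j h).1 i = j := by simpa using affineSwap_left i j 0 h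
  have htj : (affineSwap i j h).1 j = i := by simpa using affineSwap_right i j 0 h
  have := affineLength_lt_mul_affineSwap h g hij (by
    rw [hg]
    change f.1 ((affineSwap i j h).1 i) < f.1 ((affineSwap i j h).1 j)
    rw [hti, htj]; exact hlt)
  rw [hg, mul_assoc, affineSwap_mul_self, mul_one] at this
  rw [hg] at hl
  omega

/-- A Bruhat step into a bounded element comes from a bounded element. -/
theorem bounded_of_step {f g t : AffinePerm n} (hg : ∀ i, i ≤ g.1 i ∧ g.1 i ≤ i + n)
    (ht : IsAffineReflection t) (hgt : g = f * t) (hl : affineLength f < affineLength g) :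
    ∀ i, i ≤ f.1 i ∧ f.1 i ≤ i + n := by
  obtain ⟨i, j, h, hij, hlt, rfl⟩ := exists_affineSwap_of_step ht hgt hl
  have hti : (affineSwap i j h).1 i = j := by simpa using affineSwap_left i j 0 h
  have htj : (affineSwap i j h).1 j = i := by simpa using affineSwap_right i j 0 h
  have := bounded_mul_affineSwap hg h hij (by
    change f.1 ((affineSwap i j h).1 j) < f.1 ((affineSwap i j h).1 i)
    rw [hti, htj]; exact hlt)
  rwa [mul_assoc, affineSwap_mul_self, mul_one] at this

theorem AffineBruhatLE.bounded {f g : AffinePerm n} (h : AffineBruhatLE f g)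
    (hg : ∀ i, i ≤ g.1 i ∧ g.1 i ≤ i + n) : ∀ i, i ≤ f.1 i ∧ f.1 i ≤ i + n := by
  induction h using Relation.ReflTransGen.head_induction_on with
  | refl => exact hg
  | head hs _ ih =>
    obtain ⟨t, ht, he, hl⟩ := hs
    exact bounded_of_step ih ht he hl

theorem AffineBruhatLE.eq_or_affineLength_lt {f g : AffinePerm n} (h : AffineBruhatLE f g) :
    f = g ∨ affineLength f < affineLength g := by
  induction h with
  | refl => exact Or.inl rfl
  | tail _ hs ih =>
    obtain ⟨t, -, -, hl⟩ := hs
    right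
    rcases ih with rfl | ih
    · exact hl
    · exact ih.trans hl

end Bounded

/-! ### Covers of bounded affine permutations and intervals -/

section Cover

variable {n : ℕ} [NeZero n]

/-- A cover `f ⋖ f t` shrinks a given interval representing `f` at one of its end points. -/
theorem KCriterion.exists_of_cover {k : ℕ} (hk : k ≤ n) {u w : Equiv.Perm (Fin n)}
    (hc : KCriterion k u w) {i j : ℤ} (h : ¬ (n : ℤ) ∣ j - i) (hij : i < j)
    (hf : (fuw k u w).1 i < (fuw k u w).1 j)
    (hb : ∀ m, m ≤ (fuw k u w * affineSwap i j h).1 m ∧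
      (fuw k u w * affineSwap i j h).1 m ≤ m + n)
    (hl : affineLength (fuw k u w * affineSwap i j h) = affineLength (fuw k u w) + 1) :
    ∃ u' w' : Equiv.Perm (Fin n), KCriterion k u' w' ∧
      fuw k u' w' = fuw k u w * affineSwap i j h ∧ BruhatLE u u' ∧ BruhatLE w' w := by
  have hlen := affineLength_fuw hk u w
  rw [hc.blockDefect] at hlen
  -- the two ways of shrinking the interval
  have left : ∀ a b : Fin n, a < b → u a < u b →
      fuw k (u * Equiv.swap a b) w = fuw k u w * affineSwap i j h →
      ∃ u' w' : Equiv.Perm (Fin n), KCriterion k u' w' ∧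
      fuw k u' w' = fuw k u w * affineSwap i j h ∧ BruhatLE u u' ∧ BruhatLE w' w := by
    intro a b hab hu he
    have h1 := permLength_lt_mul_swap u hab hu
    have h2 := affineLength_fuw hk (u * Equiv.swap a b) w
    rw [he, hl] at h2
    push_cast at h2 hlen
    rw [← he] at hb
    obtain ⟨h3, h4⟩ := le_and_ge_of_bounded hb
    exact ⟨_, w, KCriterion.of_blockDefect h3 h4 (by omega), he, bruhatLE_mul_swap u hab hu,
      Relation.ReflTransGen.refl⟩
  have right : ∀ a b : Fin n, a < b → w b < w a →
      fuw k u (w * Equiv.swap a b) = fuw k u w * affineSwap i j h →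
      ∃ u' w' : Equiv.Perm (Fin n), KCriterion k u' w' ∧
      fuw k u' w' = fuw k u w * affineSwap i j h ∧ BruhatLE u u' ∧ BruhatLE w' w := by
    intro a b hab hw he
    have hw' : (w * Equiv.swap a b) a < (w * Equiv.swap a b) b := by simpa using hw
    have h1 := permLength_lt_mul_swap _ hab hw'
    have h0 := bruhatLE_mul_swap _ hab hw'
    rw [mul_assoc, Equiv.swap_mul_self, mul_one] at h1 h0
    have h2 := affineLength_fuw hk u (w * Equiv.swap a b)
    rw [he, hl] at h2
    push_cast at h2 hlen
    rw [← he] at hb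
    obtain ⟨h3, h4⟩ := le_and_ge_of_bounded hb
    exact ⟨u, _, KCriterion.of_blockDefect h3 h4 (by omega), he, Relation.ReflTransGen.refl, h0⟩
  obtain ⟨q, a, hia⟩ := exists_eq_window w i
  obtain ⟨s, b, hjb⟩ := exists_eq_window w j
  obtain ⟨m, hm⟩ : ∃ m : ℤ, s = q + m := ⟨s - q, by ring⟩
  have hab : a ≠ b := by
    rintro rfl
    exact h ⟨s - q, by rw [hia, hjb]; ring⟩
  have hshift : ∃ h', affineSwap i j h = affineSwap (n := n) (((w a).val : ℤ) + 1)
      (((w b).val : ℤ) + 1 + m * n) h' := by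
    refine ⟨not_dvd_val_sub _ _ (w.injective.ne hab) m, ?_⟩
    ext x
    rcases affineSwap_cases _ _ x (not_dvd_val_sub _ _ (w.injective.ne hab) m) with
      ⟨r, h1, h2⟩ | ⟨r, h1, h2⟩ | ⟨h1, h2, h3⟩
    · have h4 := affineSwap_left i j (r - q) h
      rw [show i + (r - q) * n = x by rw [hia, h1]; ring] at h4
      rw [h2, h4, hjb, hm]; ring
    · have h4 := affineSwap_right i j (r - q) h
      rw [show j + (r - q) * n = x by rw [hjb, h1, hm]; ring] at h4
      rw [h2, h4, hia]; ring
    · rw [h3]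
      rcases affineSwap_cases i j x h with ⟨r, h4, h5⟩ | ⟨r, h4, h5⟩ | ⟨h4, h5, h6⟩
      · exact absurd ⟨r + q, by rw [h4, hia]; ring⟩ h1
      · exact absurd ⟨r + q, by rw [h4, hjb, hm]; ring⟩ h2
      · exact h6
  have h1 : i ≤ (fuw k u w).1 i ∧ (fuw k u w).1 j ≤ i + n := by
    have := (hb i).2
    change (fuw k u w).1 ((affineSwap i j h).1 i) ≤ _ at this
    have hti : (affineSwap i j h).1 i = j := by simpa using affineSwap_left i j 0 h
    rw [hti] at this
    exact ⟨(hc.bounded i).1, this⟩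
  -- Boundedness after the exchange gives $j\le f(i)<f(j)\le i+n$, which limits the shift $m$
  -- between the windows of $i$ and $j$ to $0$ or $1$.
  have h2 : j ≤ (fuw k u w).1 i := by
    have := (hb j).1
    change _ ≤ (fuw k u w).1 ((affineSwap i j h).1 j) at this
    have htj : (affineSwap i j h).1 j = i := by simpa using affineSwap_right i j 0 h
    rw [htj] at this
    exact this
  rw [hia, fuw_apply] at h1 h2 hf
  rw [hjb] at h2
  rw [hjb, fuw_apply] at hf h1
  rw [hia, hjb] at hij
  rw [hm] at hij hf h1 h2
  simp only [add_mul] at hij hf h1 h2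
  obtain ⟨h', hs⟩ := hshift
  have := (w a).isLt
  have := (w b).isLt
  have := (u a).isLt
  have := (u b).isLt
  have hn : (0 : ℤ) < n := by omega
  have ha_cases := omega_cases k a
  have hb_cases := omega_cases k b
  have hn1 : (-1) * (n : ℤ) < m * n := by omega
  have hn2 : m * (n : ℤ) < 2 * n := by
    rcases ha_cases with ⟨h5, h6⟩ | ⟨h5, h6⟩ <;> rcases hb_cases with ⟨h7, h8⟩ | ⟨h7, h8⟩ <;>
      rw [h6, h8] at h1 <;> omega
  have hn1' := lt_of_mul_lt_mul_right hn1 hn.le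
  have hn2' := lt_of_mul_lt_mul_right hn2 hn.le
  have hne : a.val ≠ b.val := fun h => hab (Fin.ext h)
  obtain rfl | rfl : m = 0 ∨ m = 1 := by omega
  · have hsw : fuw k u w * affineSwap i j h = fuw k u (w * Equiv.swap a b) := by
      rw [← fuw_mul_affineSwap k u w hab, hs]
      congr 2
      all_goals simp
    have hsw' : SameBlock k a b →
        fuw k u w * affineSwap i j h = fuw k (u * Equiv.swap a b) w := fun hsb => by
      rw [hsw, fuw_mul_swap_swap k u w hsb]
    rcases lt_or_gt_of_ne hab with hlt | hlt
    -- With $a<b$ in different blocks, $f(i)$ would carry the extra $n$ and $f(j)$ would not,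
    -- contradicting $f(i)<f(j)$.
    · have hsb : SameBlock k a b ∧ u a < u b := by
        unfold SameBlock
        rw [Fin.lt_def] at hlt ⊢
        rcases ha_cases with ⟨h5, h6⟩ | ⟨h5, h6⟩ <;> rcases hb_cases with ⟨h7, h8⟩ | ⟨h7, h8⟩ <;>
          rw [h6, h8] at hf <;> omega
      exact left a b hlt hsb.2 (hsw' hsb.1).symm
    · refine right b a hlt (Fin.lt_def.2 (by omega)) ?_
      rw [hsw, Equiv.swap_comm]
  · have hcr : a.val < k ∧ ¬ b.val < k ∧ u a < u b := by
      rw [Fin.lt_def]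
      rcases ha_cases with ⟨h5, h6⟩ | ⟨h5, h6⟩ <;> rcases hb_cases with ⟨h7, h8⟩ | ⟨h7, h8⟩ <;>
        rw [h6] at h2 hf <;> rw [h8] at hf h1 <;> omega
    refine left a b (Fin.lt_def.2 (by omega)) hcr.2.2 ?_
    rw [← fuw_mul_affineSwap_shift k u w hab hcr.1 hcr.2.1, hs]

end Cover

/-! ### Rank numbers of bounded affine permutations -/

section Rank

variable {n : ℕ} [NeZero n]

/-- The number of positions `p ≥ r` with `f p ≤ q`, for `f` with `p ≤ f p` for all `p`. -/
noncomputable def lowCount (f : AffinePerm n) (r q : ℤ) : ℕ :=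
  ((Finset.Icc r q).filter fun p => f.1 p ≤ q).card

variable {f g : AffinePerm n}

theorem lowCount_add_mul (f : AffinePerm n) (r q m : ℤ) :
    lowCount f (r + m * n) (q + m * n) = lowCount f r q := by
  symm
  refine Finset.card_bij (fun p _ => p + m * n) ?_ ?_ ?_
  · intro p hp
    simp only [Finset.mem_filter, Finset.mem_Icc] at hp ⊢
    rw [affine_apply_add_mul]
    omega
  · intro p _ p' _ h
    linarith
  · intro p hp
    refine ⟨p - m * n, ?_, by ring⟩
    simp only [Finset.mem_filter, Finset.mem_Icc] at hp ⊢
    have := affine_apply_add_mul f (p - m * n) m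
    rw [sub_add_cancel] at this
    omega

theorem lowCount_eq_zero (f : AffinePerm n) {r q : ℤ} (h : q < r) : lowCount f r q = 0 := by
  rw [lowCount, Finset.Icc_eq_empty (not_le.2 h)]; rfl

theorem lowCount_split (hf : ∀ i, i ≤ f.1 i) {r r' : ℤ} (h : r ≤ r') (q : ℤ) :
    lowCount f r q = lowCount f r' q + ((Finset.Ico r r').filter fun p => f.1 p ≤ q).card := by
  rw [lowCount, lowCount, ← Finset.card_union_of_disjoint]
  · congr 1
    ext p
    have := hf p
    simp only [Finset.mem_union, Finset.mem_filter, Finset.mem_Icc, Finset.mem_Ico]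
    omega
  · rw [Finset.disjoint_left]
    intro p h1 h2
    simp only [Finset.mem_filter, Finset.mem_Icc, Finset.mem_Ico] at h1 h2
    omega

theorem lowCount_succ (hf : ∀ i, i ≤ f.1 i) (r q : ℤ) :
    lowCount f r q = lowCount f (r + 1) q + if f.1 r ≤ q then 1 else 0 := by
  rw [lowCount_split hf (show r ≤ r + 1 by omega)]
  congr 1
  rw [show Finset.Ico r (r + 1) = {r} by ext; simp only [Finset.mem_Ico, Finset.mem_singleton]; omega,
    Finset.filter_singleton]
  split_ifs <;> rfl

/-- Count the complement: exactly $k$ positions in $(q-n,q]$ have value above $q$, and those not in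
$[r,q]$ lie to the left of $r$. For long ranges the correction vanishes, so all bounded elements
have the same rank there. -/
theorem lowCount_eq {k : ℕ} (hf : f ∈ Bound k n) {r q : ℤ} (h : r ≤ q + 1) :
    (lowCount f r q : ℤ) = q - r + 1 - k +
      ((Finset.Ioc (q - n) q).filter fun s => s < r ∧ q < f.1 s).card := by
  have h1 := Finset.card_filter_add_card_filter_not (s := Finset.Icc r q) (fun p => f.1 p ≤ q)
  rw [Int.card_Icc] at h1
  have h2 := card_window_gt hf q
  have h3 := Finset.card_filter_add_card_filter_not
    (s := (Finset.Ioc (q - n) q).filter fun s => q < f.1 s) (fun p => p < r)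
  rw [h2, Finset.filter_filter, Finset.filter_filter] at h3
  have h4 : (Finset.Icc r q).filter (fun p => ¬ f.1 p ≤ q) =
      (Finset.Ioc (q - n) q).filter (fun a => q < f.1 a ∧ ¬ a < r) := by
    ext p
    have := hf.2 p
    simp only [Finset.mem_filter, Finset.mem_Icc, Finset.mem_Ioc]
    omega
  have h5 : (Finset.Ioc (q - n) q).filter (fun s => s < r ∧ q < f.1 s) =
      (Finset.Ioc (q - n) q).filter (fun a => q < f.1 a ∧ a < r) := by
    ext p; simp only [Finset.mem_filter, and_comm]
  rw [h5]
  rw [h4] at h1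
  unfold lowCount
  omega

theorem lowCount_eq_of_le {k : ℕ} (hf : f ∈ Bound k n) {r q : ℤ} (h : r + n - 1 ≤ q) :
    (lowCount f r q : ℤ) = q - r + 1 - k := by
  rw [lowCount_eq hf (by omega), Finset.filter_false_of_mem]
  · simp
  · intro s hs h1
    have := hf.2 s
    rw [Finset.mem_Ioc] at hs
    omega

theorem eq_of_lowCount_eq (hf : ∀ i, i ≤ f.1 i) (hg : ∀ i, i ≤ g.1 i)
    (h : ∀ r q, lowCount f r q = lowCount g r q) : f = g := by
  ext r
  have key : ∀ q, f.1 r ≤ q ↔ g.1 r ≤ q := by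
    intro q
    have h1 := lowCount_succ hf r q
    have h2 := lowCount_succ hg r q
    rw [h, h] at h1
    split_ifs at h1 h2 with h3 h4 h4
    · exact ⟨fun _ => h4, fun _ => h3⟩
    · omega
    · omega
    · exact ⟨fun h5 => absurd h5 h3, fun h5 => absurd h5 h4⟩
  exact le_antisymm ((key _).2 le_rfl) ((key _).1 le_rfl)

/-- Ranks can change only on translates of the box $(i,j]\times[f(i),f(j))$. As $j<i+n$, the
translates of $(i,j]$ are disjoint, so the change is at most one. -/
theorem lowCount_mul_affineSwap {i j : ℤ} (h : ¬ (n : ℤ) ∣ j - i) (hij : i < j) (hjn : j < i + n)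
    (hlt : f.1 i < f.1 j) (hf : ∀ m, m ≤ f.1 m) (hg : ∀ m, m ≤ (f * affineSwap i j h).1 m)
    (r q : ℤ) :
    lowCount (f * affineSwap i j h) r q = lowCount f r q ∨
    (lowCount (f * affineSwap i j h) r q = lowCount f r q + 1 ∧
      ∃ m : ℤ, i + m * n < r ∧ r ≤ j + m * n ∧ f.1 i + m * n ≤ q ∧ q < f.1 j + m * n) := by
  set t := affineSwap i j h with ht
  set A := (Finset.Icc r q).filter fun p => f.1 p ≤ q with hA
  -- Taking the image under $t$ makes both sets subject to the same condition $f(p)\le q$, so they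
  -- differ at most in one translate of $i$ and of $j$.
  set B := ((Finset.Icc r q).filter fun p => (f * t).1 p ≤ q).image t.1 with hB
  have htt : ∀ m, t.1 (t.1 m) = m := fun m => affineSwap_apply_apply i j m h
  have hBcard : lowCount (f * t) r q = B.card := by
    rw [hB, Finset.card_image_of_injective _ t.1.injective]; rfl
  have hAcard : lowCount f r q = A.card := rfl
  have memA : ∀ p, p ∈ A ↔ r ≤ p ∧ f.1 p ≤ q := by
    intro p
    have := hf p
    simp only [hA, Finset.mem_filter, Finset.mem_Icc]
    omega
  have memB : ∀ p, p ∈ B ↔ r ≤ t.1 p ∧ f.1 p ≤ q := by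
    intro p
    simp only [hB, Finset.mem_image, Finset.mem_filter, Finset.mem_Icc]
    constructor
    · rintro ⟨x, ⟨⟨h1, h2⟩, h3⟩, rfl⟩
      rw [htt]
      exact ⟨h1, h3⟩
    · rintro ⟨h1, h2⟩
      have h3 := hg (t.1 p)
      have h4 : (f * t).1 (t.1 p) = f.1 p := by
        change f.1 (t.1 (t.1 p)) = _
        rw [htt]
      rw [h4] at h3
      exact ⟨t.1 p, ⟨⟨h1, by omega⟩, by omega⟩, htt p⟩
  rw [hBcard, hAcard]
  by_cases hm : ∃ m : ℤ, i + m * n < r ∧ r ≤ j + m * n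
  · obtain ⟨m, hm1, hm2⟩ := hm
    have hn : (0 : ℤ) < n := by omega
    have tx : t.1 (i + m * n) = j + m * n := affineSwap_left i j m h
    have ty : t.1 (j + m * n) = i + m * n := affineSwap_right i j m h
    have fx := affine_apply_add_mul f i m
    have fy := affine_apply_add_mul f j m
    have huniq : ∀ m' : ℤ, i + m' * n < r → r ≤ j + m' * n → m' = m := by
      intro m' h1 h2
      have h3 : (m' - m) * n < 1 * n := by linarith
      have h4 : (-1) * (n : ℤ) < (m' - m) * n := by linarith
      have := lt_of_mul_lt_mul_right h3 hn.le
      have := lt_of_mul_lt_mul_right h4 hn.le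
      omega
    have hAB : A.erase (j + m * n) = B.erase (i + m * n) := by
      ext p
      rw [Finset.mem_erase, Finset.mem_erase, memA, memB]
      rcases affineSwap_cases i j p h with ⟨s, rfl, h1⟩ | ⟨s, rfl, h1⟩ | ⟨h1, h2, h3⟩
      · rw [← ht] at h1
        rw [h1]
        constructor
        · rintro ⟨h2, h3, h4⟩
          refine ⟨fun h5 => ?_, by omega, h4⟩
          omega
        · rintro ⟨h2, h3, h4⟩
          refine ⟨fun h5 => h ⟨s - m, by linarith⟩, ?_, h4⟩
          by_contra h5
          have := huniq s (by omega) h3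
          subst this
          exact h2 rfl
      · rw [← ht] at h1
        rw [h1]
        constructor
        · rintro ⟨h2, h3, h4⟩
          refine ⟨fun h5 => h ⟨m - s, by linarith⟩, ?_, h4⟩
          by_contra h5
          have := huniq s (by omega) h3
          subst this
          exact h2 rfl
        · rintro ⟨h2, h3, h4⟩
          refine ⟨fun h5 => ?_, by omega, h4⟩
          omega
      · rw [← ht] at h3
        rw [h3]
        have e1 : p ≠ j + m * n := by rintro rfl; exact h2 ⟨m, by ring⟩
        have e2 : p ≠ i + m * n := by rintro rfl; exact h1 ⟨m, by ring⟩
        simp [e1, e2]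
    have hxA : (j + m * n) ∈ A ↔ f.1 j + m * n ≤ q := by
      rw [memA, fy]; exact and_iff_right hm2
    have hxB : (i + m * n) ∈ B ↔ f.1 i + m * n ≤ q := by
      rw [memB, fx, tx]; exact and_iff_right hm2
    have hcard := congrArg Finset.card hAB
    rw [Finset.card_erase_eq_ite, Finset.card_erase_eq_ite] at hcard
    by_cases h1 : f.1 j + m * n ≤ q
    · have h2 : f.1 i + m * n ≤ q := by omega
      rw [if_pos (hxA.2 h1), if_pos (hxB.2 h2)] at hcard
      have := Finset.card_pos.2 ⟨_, hxA.2 h1⟩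
      have := Finset.card_pos.2 ⟨_, hxB.2 h2⟩
      left; omega
    · rw [if_neg (mt hxA.1 h1)] at hcard
      by_cases h2 : f.1 i + m * n ≤ q
      · rw [if_pos (hxB.2 h2)] at hcard
        have := Finset.card_pos.2 ⟨_, hxB.2 h2⟩
        exact Or.inr ⟨by omega, m, hm1, hm2, h2, by omega⟩
      · rw [if_neg (mt hxB.1 h2)] at hcard
        left; omega
  · left
    congr 1
    ext p
    rw [memA, memB]
    have hm' : ∀ m : ℤ, i + m * n < r → ¬ r ≤ j + m * n := fun m h1 h2 => hm ⟨m, h1, h2⟩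
    rcases affineSwap_cases i j p h with ⟨s, rfl, h1⟩ | ⟨s, rfl, h1⟩ | ⟨h1, h2, h3⟩
    · rw [← ht] at h1
      have := hm' s
      rw [h1]; omega
    · rw [← ht] at h1
      have := hm' s
      rw [h1]; omega
    · rw [← ht] at h3
      rw [h3]

theorem AffineBruhatLE.lowCount_le (h : AffineBruhatLE f g)
    (hg : ∀ i, i ≤ g.1 i ∧ g.1 i ≤ i + n) (r q : ℤ) : lowCount f r q ≤ lowCount g r q := by
  induction h using Relation.ReflTransGen.head_induction_on with
  | refl => exact le_rfl
  | @head f₁ f₂ hs h₂ ih =>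
    obtain ⟨t, ht, he, hl⟩ := hs
    have hb₂ := AffineBruhatLE.bounded h₂ hg
    have hb₁ := bounded_of_step hb₂ ht he hl
    obtain ⟨i, j, h, hij, hlt, rfl⟩ := exists_affineSwap_of_step ht he hl
    have hti : (affineSwap i j h).1 i = j := by simpa using affineSwap_left i j 0 h
    have htj : (affineSwap i j h).1 j = i := by simpa using affineSwap_right i j 0 h
    have h1 := (hb₂ i).2
    have h2 := (hb₂ j).1
    change f₁.1 ((affineSwap i j h).1 i) ≤ _ at h1
    change _ ≤ f₁.1 ((affineSwap i j h).1 j) at h2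
    rw [hti] at h1
    rw [htj] at h2
    have := lowCount_mul_affineSwap h hij (by omega) hlt (fun m => (hb₁ m).1)
      (fun m => (hb₂ m).1) r q
    omega

/-- If the rank numbers of `f ≠ g` are comparable, then `f` can be raised towards `g` by a
transposition without intermediate points. -/
theorem exists_cover_of_lowCount_le {k : ℕ} (hf : f ∈ Bound k n) (hg : g ∈ Bound k n)
    (hle : ∀ r q, lowCount f r q ≤ lowCount g r q) (hne : f ≠ g) :
    ∃ (i j : ℤ) (h : ¬ (n : ℤ) ∣ j - i), i < j ∧ j < i + n ∧ f.1 i < f.1 j ∧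
      (∀ p, i < p → p < j → f.1 i < f.1 p → ¬ f.1 p < f.1 j) ∧
      (∀ m, m ≤ (f * affineSwap i j h).1 m ∧ (f * affineSwap i j h).1 m ≤ m + n) ∧
      ∀ r q, lowCount (f * affineSwap i j h) r q ≤ lowCount g r q := by
  have hf1 : ∀ m, m ≤ f.1 m := fun m => (hf.2 m).1
  have hg1 : ∀ m, m ≤ g.1 m := fun m => (hg.2 m).1
  obtain ⟨p₀, q₀, hpos⟩ : ∃ r q, lowCount f r q < lowCount g r q := by
    by_contra! hc
    exact hne (eq_of_lowCount_eq hf1 hg1 fun r q => le_antisymm (hle r q) (hc r q))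
  have hfull : ∀ r q : ℤ, r + n - 1 ≤ q → lowCount f r q = lowCount g r q := by
    intro r q hrq
    have h1 := lowCount_eq_of_le hf hrq
    have h2 := lowCount_eq_of_le hg hrq
    omega
  have hp₀ : q₀ - n + 1 < p₀ := by
    by_contra hc
    exact hpos.ne (hfull _ _ (by omega))
  have hp₀' : p₀ ≤ q₀ := by
    by_contra hc
    rw [lowCount_eq_zero g (by omega)] at hpos
    omega
  -- At level $q_0$, the strict inequality of ranks holds on a maximal run $i<r<p$ around $p_0$,
  -- with equality at both ends. Equality far to the left and beyond $q_0$ makes the run finite.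
  obtain ⟨i, ⟨hi1, hi2⟩, himax⟩ := Int.exists_greatest_of_bdd
    (P := fun r => r ≤ p₀ ∧ lowCount f r q₀ = lowCount g r q₀)
    ⟨p₀, fun z hz => hz.1⟩ ⟨q₀ - n + 1, by omega, hfull _ _ (by omega)⟩
  obtain ⟨p, ⟨hp1, hp2⟩, hpmin⟩ := Int.exists_least_of_bdd
    (P := fun r => p₀ ≤ r ∧ lowCount f r q₀ = lowCount g r q₀)
    ⟨p₀, fun z hz => hz.1⟩ ⟨q₀ + 1, by omega, by
      rw [lowCount_eq_zero f (by omega), lowCount_eq_zero g (by omega)]⟩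
  have hi3 : q₀ - n + 1 ≤ i := himax _ ⟨by omega, hfull _ _ (by omega)⟩
  have hp3 : p ≤ q₀ + 1 := hpmin _ ⟨by omega, by
      rw [lowCount_eq_zero f (by omega), lowCount_eq_zero g (by omega)]⟩
  have hip₀ : i < p₀ := lt_of_le_of_ne hi1 (by rintro rfl; omega)
  have hpp₀ : p₀ < p := lt_of_le_of_ne hp1 (by rintro rfl; omega)
  have hmid : ∀ r, i < r → r < p → lowCount f r q₀ < lowCount g r q₀ := by
    intro r h1 h2
    refine lt_of_le_of_ne (hle r q₀) fun he => ?_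
    rcases le_total r p₀ with h3 | h3
    · have := himax r ⟨h3, he⟩; omega
    · have := hpmin r ⟨h3, he⟩; omega
  have hfi : f.1 i ≤ q₀ := by
    have h1 := lowCount_succ hf1 i q₀
    have h2 := lowCount_succ hg1 i q₀
    have h3 := hmid (i + 1) (by omega) (by omega)
    split_ifs at h1 h2 with h4 h5 h5 <;> first | exact h4 | omega
  have hfp : q₀ < f.1 (p - 1) := by
    have h1 := lowCount_succ hf1 (p - 1) q₀
    have h2 := lowCount_succ hg1 (p - 1) q₀
    rw [sub_add_cancel] at h1 h2
    have h3 := hmid (p - 1) (by omega) (by omega)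
    split_ifs at h1 h2 with h4 h5 h5 <;> omega
  -- A pair $a<b$ in the run whose values straddle $q_0$ as tightly as possible; $(i,p-1)$ shows
  -- that one exists.
  obtain ⟨⟨a, b⟩, hab, hmin⟩ := Finset.exists_min_image
    ((Finset.Ico i p ×ˢ Finset.Ico i p).filter fun x => x.1 < x.2 ∧ f.1 x.1 ≤ q₀ ∧ q₀ < f.1 x.2)
    (fun x => f.1 x.2 - f.1 x.1) ⟨(i, p - 1), by
      simp only [Finset.mem_filter, Finset.mem_product, Finset.mem_Ico]; omega⟩
  simp only [Finset.mem_filter, Finset.mem_product, Finset.mem_Ico] at hab hmin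
  obtain ⟨⟨⟨ha1, ha2⟩, hb1, hb2⟩, hlt, hfa, hfb⟩ := hab
  have hup : ∀ s, a < s → s < p → q₀ < f.1 s → f.1 b ≤ f.1 s := by
    intro s h1 h2 h3
    have := hmin (a, s) ⟨⟨⟨ha1, ha2⟩, by omega, h2⟩, h1, hfa, h3⟩
    simp only at this
    omega
  have hdown : ∀ s, i ≤ s → s < b → f.1 s ≤ q₀ → f.1 s ≤ f.1 a := by
    intro s h1 h2 h3
    have := hmin (s, b) ⟨⟨⟨h1, by omega⟩, hb1, hb2⟩, h2, h3, hfb⟩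
    simp only at this
    omega
  -- Strictness spreads from level $q_0$ to the whole box. By minimality, $f$ has no values between
  -- $q_0$ and $q$ on $[r,p)$ (for $q\ge q_0$) or on $[i,r)$ (for $q\le q_0$), while the count for
  -- $g$ is monotone in $q$. The comparison is anchored at $p$ or $i$, where the ranks at level
  -- $q_0$ agree.
  have hbox : ∀ r q, a < r → r ≤ b → f.1 a ≤ q → q < f.1 b → lowCount f r q < lowCount g r q := by
    intro r q h1 h2 h3 h4
    have h5 := hmid r (by omega) (by omega)
    rcases le_total q₀ q with hq | hq
    · have e1 := lowCount_split hf1 (show r ≤ p by omega) q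
      have e2 := lowCount_split hf1 (show r ≤ p by omega) q₀
      have e3 := lowCount_split hg1 (show r ≤ p by omega) q
      have e4 := lowCount_split hg1 (show r ≤ p by omega) q₀
      have e5 : (Finset.Ico r p).filter (fun s => f.1 s ≤ q) =
          (Finset.Ico r p).filter (fun s => f.1 s ≤ q₀) := by
        refine Finset.filter_congr fun s hs => ⟨fun h6 => ?_, fun h6 => h6.trans hq⟩
        rw [Finset.mem_Ico] at hs
        by_contra h7
        have := hup s (by omega) hs.2 (by omega)
        omega
      have e6 : ((Finset.Ico r p).filter (fun s => g.1 s ≤ q₀)).card ≤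
          ((Finset.Ico r p).filter (fun s => g.1 s ≤ q)).card :=
        Finset.card_le_card (Finset.monotone_filter_right _ fun s _ h6 => h6.trans hq)
      have e7 := hle p q
      rw [e5] at e1
      omega
    · have e1 := lowCount_split hf1 (show i ≤ r by omega) q
      have e2 := lowCount_split hf1 (show i ≤ r by omega) q₀
      have e3 := lowCount_split hg1 (show i ≤ r by omega) q
      have e4 := lowCount_split hg1 (show i ≤ r by omega) q₀
      have e5 : (Finset.Ico i r).filter (fun s => f.1 s ≤ q) =
          (Finset.Ico i r).filter (fun s => f.1 s ≤ q₀) := by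
        refine Finset.filter_congr fun s hs => ⟨fun h6 => h6.trans hq, fun h6 => ?_⟩
        rw [Finset.mem_Ico] at hs
        exact (hdown s hs.1 (by omega) h6).trans h3
      have e6 : ((Finset.Ico i r).filter (fun s => g.1 s ≤ q)).card ≤
          ((Finset.Ico i r).filter (fun s => g.1 s ≤ q₀)).card :=
        Finset.card_le_card (Finset.monotone_filter_right _ fun s _ h6 => h6.trans hq)
      have e7 := hle i q
      rw [e5] at e1
      omega
  -- Boundedness after the exchange comes from corners of the box: ranks with $q<r$ are zero, and
  -- ranks with $q\ge r+n-1$ agree for $f$ and $g$, so neither can be strict.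
  have hbfa : b ≤ f.1 a := by
    have h1 := hbox b (f.1 a) hlt le_rfl le_rfl (by omega)
    by_contra hc
    rw [lowCount_eq_zero g (by omega)] at h1
    omega
  have hfba : f.1 b ≤ a + n := by
    have h1 := hbox (a + 1) (f.1 b - 1) (by omega) (by omega) (by omega) (by omega)
    by_contra hc
    exact h1.ne (hfull _ _ (by omega))
  have hnd : ¬ (n : ℤ) ∣ b - a := fun hd => by
    have := Int.le_of_dvd (by omega) hd
    omega
  have hbd : ∀ m, m ≤ (f * affineSwap a b hnd).1 m ∧ (f * affineSwap a b hnd).1 m ≤ m + n := by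
    intro m
    change m ≤ f.1 ((affineSwap a b hnd).1 m) ∧ f.1 ((affineSwap a b hnd).1 m) ≤ m + n
    rcases affineSwap_cases a b m hnd with ⟨r, rfl, h3⟩ | ⟨r, rfl, h3⟩ | ⟨-, -, h3⟩
    · rw [h3, affine_apply_add_mul]; constructor <;> omega
    · rw [h3, affine_apply_add_mul]; constructor <;> omega
    · rw [h3]; exact hf.2 m
  refine ⟨a, b, hnd, hlt, by omega, by omega, ?_, hbd, ?_⟩
  · intro s h1 h2 h3 h4
    by_cases h5 : f.1 s ≤ q₀
    · have := hdown s (by omega) h2 h5; omega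
    · have := hup s h1 (by omega) (by omega); omega
  · intro r q
    rcases lowCount_mul_affineSwap hnd hlt (by omega) (by omega) hf1 (fun m => (hbd m).1) r q with
      h1 | ⟨h1, m, h2, h3, h4, h5⟩
    · rw [h1]; exact hle r q
    · rw [h1]
      have h6 := hbox (r + (-m) * n) (q + (-m) * n) (by linarith) (by linarith) (by linarith)
        (by linarith)
      rw [lowCount_add_mul, lowCount_add_mul] at h6
      omega

/-- Comparable rank numbers give a Bruhat chain, and a nested interval for each interval
representing the lower end. -/
theorem KCriterion.exists_of_lowCount_le {k : ℕ} (hk : k ≤ n) (hg : g ∈ Bound k n)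
    {u w : Equiv.Perm (Fin n)} (hc : KCriterion k u w)
    (hle : ∀ r q, lowCount (fuw k u w) r q ≤ lowCount g r q) :
    AffineBruhatLE (fuw k u w) g ∧ ∃ u' w' : Equiv.Perm (Fin n), KCriterion k u' w' ∧
      fuw k u' w' = g ∧ BruhatLE u u' ∧ BruhatLE w' w := by
  have hbound : ∀ u w : Equiv.Perm (Fin n), KCriterion k u w →
      affineLength (fuw k u w) ≤ k * n + n * n := by
    intro u w hc
    have h1 := affineLength_fuw hk u w
    rw [hc.blockDefect] at h1
    have h2 := permLength_le u
    have h3 : (k : ℤ) * (n - k) ≤ k * n := by nlinarith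
    have h4 : (affineLength (fuw k u w) : ℤ) ≤ ((k * n + n * n : ℕ) : ℤ) := by
      push_cast
      have : (permLength u : ℤ) ≤ n * n := by exact_mod_cast h2
      have : (0 : ℤ) ≤ permLength w := by positivity
      push_cast at h1
      linarith
    exact_mod_cast h4
  -- Each cover lengthens $f_{u,w}$, and the length formula bounds this length, so the climb towards
  -- $g$ ends.
  induction hm : k * n + n * n - affineLength (fuw k u w) using Nat.strong_induction_on
    generalizing u w with
  | _ m ih =>
    by_cases hne : fuw k u w = g
    · rw [hne]
      exact ⟨Relation.ReflTransGen.refl, u, w, hc, hne, Relation.ReflTransGen.refl,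
        Relation.ReflTransGen.refl⟩
    obtain ⟨i, j, h, hij, hjn, hlt, hcov, hb, hle'⟩ :=
      exists_cover_of_lowCount_le (hc.fuw_mem_bound hk) hg hle hne
    have hl := affineLength_mul_affineSwap_of_cover h _ hij hlt hjn hcov
    obtain ⟨u₁, w₁, hc₁, he₁, hu₁, hw₁⟩ := hc.exists_of_cover hk h hij hlt hb hl
    rw [← he₁] at hl hle'
    have := hbound u₁ w₁ hc₁
    obtain ⟨h1, u₂, w₂, hc₂, he₂, hu₂, hw₂⟩ := ih _ (by omega) hc₁ hle' rfl
    refine ⟨Relation.ReflTransGen.head ⟨_, isAffineReflection_affineSwap i j h, he₁, by omega⟩ h1,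
      u₂, w₂, hc₂, he₂, hu₁.trans hu₂, hw₂.trans hw₁⟩

end Rank

/-! ### Rank numbers of permutations -/

section FiniteRank

variable {n : ℕ} [NeZero n]

/-- The number of positions below `c` with value at least `q`. -/
def permRank (u : Equiv.Perm (Fin n)) (c q : ℕ) : ℕ :=
  (Finset.univ.filter fun a : Fin n => a.val < c ∧ q ≤ (u a).val).card

/-- Comparison of all rank numbers. -/
def RankLE (u v : Equiv.Perm (Fin n)) : Prop := ∀ c q, permRank u c q ≤ permRank v c q

theorem RankLE.trans {u v w : Equiv.Perm (Fin n)} (h : RankLE u v) (h' : RankLE v w) :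
    RankLE u w := fun c q => (h c q).trans (h' c q)

theorem permRank_le_mul_swap (u : Equiv.Perm (Fin n)) {a b : Fin n} (hab : a < b)
    (hu : u a < u b) : RankLE u (u * Equiv.swap a b) := by
  intro c q
  rw [Fin.lt_def] at hab hu
  -- If both positions lie below $c$ the values are merely permuted; otherwise the only value that
  -- can change below $c$ is the one at $a$, which grows.
  refine Finset.card_le_card_of_injOn (fun x => if b.val < c then Equiv.swap a b x else x) ?_ ?_
  · intro x hx
    have hx : x.val < c ∧ q ≤ (u x).val := by simpa using hx
    suffices h : ∀ y, (if b.val < c then Equiv.swap a b x else x) = y →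
        y.val < c ∧ q ≤ ((u * Equiv.swap a b) y).val from Finset.mem_filter.2
      ⟨Finset.mem_univ _, h _ rfl⟩
    rintro y rfl
    split_ifs with hb
    · refine ⟨(inParabolic_swap (k := c) ?_ x).2 hx.1, by simpa using hx.2⟩
      unfold SameBlock; omega
    · refine ⟨hx.1, ?_⟩
      have hxb : x ≠ b := by rintro rfl; exact hb hx.1
      by_cases hxa : x = a
      · subst hxa
        simp only [Equiv.Perm.mul_apply, Equiv.swap_apply_left]
        omega
      · rw [Equiv.Perm.mul_apply, Equiv.swap_apply_of_ne_of_ne hxa hxb]; exact hx.2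
  · intro x _ y _ hxy
    simp only at hxy
    split_ifs at hxy
    · exact (Equiv.swap a b).injective hxy
    · exact hxy

theorem BruhatLE.rankLE {u v : Equiv.Perm (Fin n)} (h : BruhatLE u v) : RankLE u v := by
  induction h with
  | refl => exact fun _ _ => le_rfl
  | tail _ hs ih =>
    obtain ⟨t, ht, rfl, hl⟩ := hs
    obtain ⟨a, b, hab, hu, rfl⟩ := exists_swap_of_isSwap ht hl
    exact ih.trans (permRank_le_mul_swap _ hab hu)

theorem permRank_succ (u : Equiv.Perm (Fin n)) (a : Fin n) (q : ℕ) :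
    permRank u (a.val + 1) q = permRank u a.val q + if q ≤ (u a).val then 1 else 0 := by
  have h : (Finset.univ.filter fun x : Fin n => x.val < a.val + 1 ∧ q ≤ (u x).val) =
      (Finset.univ.filter fun x : Fin n => x.val < a.val ∧ q ≤ (u x).val) ∪
      (if q ≤ (u a).val then {a} else ∅) := by
    ext x
    simp only [Finset.mem_union, Finset.mem_filter, Finset.mem_univ, true_and]
    split_ifs with h
    · rw [Finset.mem_singleton]
      constructor
      · rintro ⟨h1, h2⟩
        rcases Nat.lt_succ_iff_lt_or_eq.1 h1 with h3 | h3
        · exact Or.inl ⟨h3, h2⟩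
        · exact Or.inr (Fin.ext h3)
      · rintro (h1 | rfl)
        · exact ⟨by omega, h1.2⟩
        · exact ⟨by omega, h⟩
    · simp only [Finset.notMem_empty, or_false]
      constructor
      · rintro ⟨h1, h2⟩
        refine ⟨lt_of_le_of_ne (by omega) fun h3 => h ?_, h2⟩
        rwa [← Fin.ext h3]
      · rintro ⟨h1, h2⟩
        exact ⟨by omega, h2⟩
  rw [permRank, h, Finset.card_union_of_disjoint]
  · congr 1
    split_ifs <;> rfl
  · rw [Finset.disjoint_left]
    intro x hx hx'
    simp only [Finset.mem_filter, Finset.mem_univ, true_and] at hx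
    split_ifs at hx'
    · rw [Finset.mem_singleton] at hx'
      subst hx'; omega
    · simp at hx'

theorem permRank_mul_swap_of_sameBlock (u : Equiv.Perm (Fin n)) {a b : Fin n} {c : ℕ}
    (h : SameBlock c a b) (q : ℕ) : permRank (u * Equiv.swap a b) c q = permRank u c q := by
  refine Finset.card_bij (fun x _ => Equiv.swap a b x) ?_ ?_ ?_
  · intro x hx
    simp only [Finset.mem_filter, Finset.mem_univ, true_and] at hx ⊢
    exact ⟨(inParabolic_swap h x).2 hx.1, hx.2⟩
  · intro x _ y _ hxy
    exact (Equiv.swap a b).injective hxy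
  · intro x hx
    simp only [Finset.mem_filter, Finset.mem_univ, true_and] at hx
    refine ⟨Equiv.swap a b x, ?_, by simp⟩
    simp only [Finset.mem_filter, Finset.mem_univ, true_and]
    exact ⟨(inParabolic_swap h x).2 hx.1, by simpa using hx.2⟩

theorem permRank_mul_swap_adjacent (u : Equiv.Perm (Fin n)) {a b : Fin n}
    (hab : b.val = a.val + 1) (q : ℕ) :
    permRank (u * Equiv.swap a b) b.val q =
      permRank u a.val q + if q ≤ (u b).val then 1 else 0 := by
  rw [hab, permRank_succ, permRank_mul_swap_of_sameBlock u (by unfold SameBlock; omega)]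
  simp

/-- Lifting property for rank numbers, smaller element ascending. -/
theorem RankLE.mul_swap_right {x y : Equiv.Perm (Fin n)} (h : RankLE x y) {a b : Fin n}
    (hab : b.val = a.val + 1) (hx : x a < x b) :
    RankLE x (y * Equiv.swap a b) := by
  intro c q
  by_cases hc : c = b.val
  -- Only the rank at the cut between $a$ and $b$ changes. It is compared through the cut before $a$
  -- if $x(a)<q$, and through the cut after $b$ if $q\le x(a)<x(b)$.
  · subst hc
    rw [permRank_mul_swap_adjacent y hab]
    rw [Fin.lt_def] at hx
    have h1 := permRank_succ x a q
    have h2 := permRank_succ x b q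
    have h3 := permRank_succ y a q
    have h4 := permRank_succ y b q
    have h5 := h a.val q
    have h6 := h (b.val + 1) q
    have h7 := h b.val q
    rw [← hab] at h1 h3
    split_ifs at * <;> omega
  · rw [permRank_mul_swap_of_sameBlock y (by unfold SameBlock; omega)]
    exact h c q

/-- Lifting property for rank numbers, smaller element descending. -/
theorem RankLE.mul_swap_mul_swap {x y : Equiv.Perm (Fin n)} (h : RankLE x y) {a b : Fin n}
    (hab : b.val = a.val + 1) (hx : x b < x a) :
    RankLE (x * Equiv.swap a b) (y * Equiv.swap a b) := by
  intro c q
  by_cases hc : c = b.val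
  · subst hc
    rw [permRank_mul_swap_adjacent y hab, permRank_mul_swap_adjacent x hab]
    rw [Fin.lt_def] at hx
    have h1 := permRank_succ x a q
    have h2 := permRank_succ x b q
    have h3 := permRank_succ y a q
    have h4 := permRank_succ y b q
    have h5 := h a.val q
    have h6 := h (b.val + 1) q
    have h7 := h b.val q
    rw [← hab] at h1 h3
    split_ifs at * <;> omega
  · rw [permRank_mul_swap_of_sameBlock y (by unfold SameBlock; omega),
      permRank_mul_swap_of_sameBlock x (by unfold SameBlock; omega)]
    exact h c q

/-! ### Reduction to Grassmannian upper end points -/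

theorem exists_adjacent_descent {k : ℕ} {w : Equiv.Perm (Fin n)} (h : ¬ Grassmannian k w) :
    ∃ a b : Fin n, b.val = a.val + 1 ∧ SameBlock k a b ∧ w b < w a := by
  by_contra! hc
  apply h
  have key : ∀ (m : ℕ) (a b : Fin n), b.val = a.val + m + 1 → SameBlock k a b → w a < w b := by
    intro m
    induction m with
    | zero =>
      intro a b hab hs
      refine lt_of_le_of_ne (hc a b hab hs) (w.injective.ne ?_)
      rintro rfl; omega
    | succ m ih =>
      intro a b hab hs
      have hb := b.isLt
      unfold SameBlock at hs
      let d : Fin n := ⟨a.val + m + 1, by omega⟩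
      have h1 := ih a d rfl (by simp only [SameBlock, d]; omega)
      have h2 := hc d b (by simp only [d]; omega) (by simp only [SameBlock, d]; omega)
      exact h1.trans_le h2
  intro a b hab hs
  rw [Fin.lt_def] at hab
  exact key (b.val - a.val - 1) a b (by omega) hs

theorem permLength_mul_swap_adjacent (w : Equiv.Perm (Fin n)) {a b : Fin n}
    (hab : b.val = a.val + 1) (hw : w b < w a) :
    permLength w = permLength (w * Equiv.swap a b) + 1 := by
  have h := permLength_mul_swap_of_cover (w * Equiv.swap a b) (a := a) (b := b)
    (Fin.lt_def.2 (by omega)) (by simpa using hw)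
    (fun c h1 h2 => by rw [Fin.lt_def] at h1 h2; omega)
  rwa [mul_assoc, Equiv.swap_mul_self, mul_one] at h

theorem permLength_swap_adjacent {a b : Fin n} (hab : b.val = a.val + 1) :
    permLength (Equiv.swap a b) = 1 := by
  have h := permLength_mul_swap_adjacent (Equiv.swap a b) hab
    (by simp [Fin.lt_def, hab])
  rwa [Equiv.swap_mul_self, permLength_one] at h

/-- A descent of $w$ inside a block must be one of $u$, by the crossing condition. Both lengths then
drop by one while $f$ is unchanged, so the defect stays zero. -/
theorem KCriterion.mul_swap {k : ℕ} (hk : k ≤ n) {u w : Equiv.Perm (Fin n)}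
    (h : KCriterion k u w) {a b : Fin n} (hab : b.val = a.val + 1) (hs : SameBlock k a b)
    (hw : w b < w a) :
    u b < u a ∧ KCriterion k (u * Equiv.swap a b) (w * Equiv.swap a b) := by
  have hu : u b < u a := by
    by_contra hc
    have hlt : u a < u b := lt_of_le_of_ne (not_lt.1 hc) (u.injective.ne (by rintro rfl; omega))
    have := h.cross a b (Fin.lt_def.2 (by omega)) hlt hw
    exact this.2 (hs.1 this.1)
  refine ⟨hu, KCriterion.of_blockDefect ?_ ?_ ?_⟩
  · intro c hc
    exact h.le _ ((inParabolic_swap hs c).2 hc)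
  · intro c hc
    exact h.ge _ (mt (inParabolic_swap hs c).1 hc)
  · have h1 := affineLength_fuw hk u w
    have h2 := affineLength_fuw hk (u * Equiv.swap a b) (w * Equiv.swap a b)
    rw [fuw_mul_right k u w _ (inParabolic_swap hs)] at h2
    have h3 := permLength_mul_swap_adjacent u hab hu
    have h4 := permLength_mul_swap_adjacent w hab hw
    rw [h.blockDefect, h3, h4] at h1
    push_cast at h1
    omega

/-- Every interval is equivalent to one with Grassmannian upper end point, and intervals nested
in the former (with respect to rank numbers) can be moved along. -/
theorem KCriterion.exists_grassmannian {k : ℕ} (hk : k ≤ n) {u w : Equiv.Perm (Fin n)}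
    (h : KCriterion k u w) :
    ∃ (u₀ w₀ : Equiv.Perm (Fin n)) (h₀ : KCriterion k u₀ w₀), Grassmannian k w₀ ∧
      (⟨u, w, h.kBruhatLE hk⟩ : KInterval k n).cls =
        (⟨u₀, w₀, h₀.kBruhatLE hk⟩ : KInterval k n).cls ∧
      fuw k u₀ w₀ = fuw k u w ∧
      ∀ u' w', KCriterion k u' w' → RankLE u u' → RankLE w' w →
        ∃ u'' w'', KCriterion k u'' w'' ∧ fuw k u'' w'' = fuw k u' w' ∧
          RankLE u₀ u'' ∧ RankLE w'' w₀ := by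
  induction hm : permLength w using Nat.strong_induction_on generalizing u w with
  | _ m ih =>
    by_cases hg : Grassmannian k w
    · exact ⟨u, w, h, hg, rfl, rfl, fun u' w' hc h1 h2 => ⟨u', w', hc, rfl, h1, h2⟩⟩
    obtain ⟨a, b, hab, hs, hw⟩ := exists_adjacent_descent hg
    obtain ⟨hu, h₁⟩ := h.mul_swap hk hab hs hw
    have hlw := permLength_mul_swap_adjacent w hab hw
    have hlu := permLength_mul_swap_adjacent u hab hu
    obtain ⟨u₀, w₀, h₀, hg₀, hcls, hfuw, hmove⟩ := ih _ (by omega) h₁ rfl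
    have hstep : IntervalStep k n ⟨_, _, h₁.kBruhatLE hk⟩ ⟨u, w, h.kBruhatLE hk⟩ := by
      refine ⟨Equiv.swap a b, inParabolic_swap hs, ⟨?_, ?_⟩, ⟨?_, ?_⟩⟩
      · simp [mul_assoc]
      · rw [permLength_swap_adjacent hab]; exact hlu
      · simp [mul_assoc]
      · rw [permLength_swap_adjacent hab]; exact hlw
    refine ⟨u₀, w₀, h₀, hg₀, (Quot.sound hstep).symm.trans hcls, ?_, ?_⟩
    · rw [hfuw, fuw_mul_right k u w _ (inParabolic_swap hs)]
    · intro u' w' hc hu' hw'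
      by_cases hd : w' b < w' a
      · obtain ⟨hud, hc₁⟩ := hc.mul_swap hk hab hs hd
        obtain ⟨u'', w'', h1, h2, h3, h4⟩ := hmove _ _ hc₁
          (hu'.mul_swap_mul_swap hab hu) (hw'.mul_swap_mul_swap hab hd)
        exact ⟨u'', w'', h1, h2.trans (fuw_mul_right k u' w' _ (inParabolic_swap hs)), h3, h4⟩
      -- Without a descent of $w'$ the inner interval stays put: the outer bottom only decreases,
      -- and lifting gives $w'\le w(ab)$ in rank order.
      · have hlt : w' a < w' b :=
          lt_of_le_of_ne (not_lt.1 hd) (w'.injective.ne (by rintro rfl; omega))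
        have hlow : RankLE (u * Equiv.swap a b) u := by
          have := permRank_le_mul_swap (u * Equiv.swap a b) (a := a) (b := b)
            (Fin.lt_def.2 (by omega)) (by simpa using hu)
          rwa [mul_assoc, Equiv.swap_mul_self, mul_one] at this
        exact hmove u' w' hc (hlow.trans hu') (hw'.mul_swap_right hab hlt)

/-! ### Rank numbers of `f_{u,w}` -/

/-- For $q\le n$ only positions in $[n]$ whose value is not shifted by $n$ contribute, namely those
from the second block. For $q\le 0$ the truncation `q.toNat` makes both sides zero. -/
theorem lowCount_fuw_of_le {k : ℕ} {u w : Equiv.Perm (Fin n)} {i : ℕ} {q : ℤ} (hq : q ≤ n)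
    (hc : KCriterion k u w) :
    lowCount (fuw k u w) ((i : ℤ) + 1) q = (Finset.univ.filter fun b : Fin n =>
      (¬ b.val < k ∧ i ≤ (w b).val) ∧ (u b).val < q.toNat).card := by
  symm
  refine Finset.card_bij (fun b _ => ((w b).val : ℤ) + 1) ?_ ?_ ?_
  · intro b hb
    simp only [Finset.mem_filter, Finset.mem_univ, true_and, Finset.mem_Icc] at hb ⊢
    have := Fin.le_def.1 (hc.ge b hb.1.1)
    rw [fuw_apply_zero]
    simp only [omega, hb.1.1, if_false]
    omega
  · intro b _ b' _ h
    apply w.injective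
    ext
    omega
  · intro p hp
    simp only [Finset.mem_filter, Finset.mem_Icc] at hp
    obtain ⟨m, b, rfl⟩ := exists_eq_window w p
    rw [fuw_apply] at hp
    have h1 := (w b).isLt
    have h2 := (u b).isLt
    have hn : (0 : ℤ) < n := by omega
    have hm1 : (-1) * (n : ℤ) < m * n := by omega
    have hm2 : m * (n : ℤ) < 1 * n := by omega
    have hm1' := lt_of_mul_lt_mul_right hm1 hn.le
    have hm2' := lt_of_mul_lt_mul_right hm2 hn.le
    obtain rfl : m = 0 := by omega
    rcases omega_cases k b with ⟨h3, h4⟩ | ⟨h3, h4⟩ <;> rw [h4] at hp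
    · omega
    · refine ⟨b, ?_, by ring⟩
      simp only [Finset.mem_filter, Finset.mem_univ, true_and]
      exact ⟨⟨h3, by omega⟩, by omega⟩

/-- For $q>n$ the complementary count is simpler: it involves only the first block. -/
theorem lowCount_fuw_of_lt {k : ℕ} (hk : k ≤ n) {u w : Equiv.Perm (Fin n)} {i : ℕ} (hi : i < n)
    {q : ℤ} (hq : n < q) (hc : KCriterion k u w) :
    (lowCount (fuw k u w) ((i : ℤ) + 1) q : ℤ) = q - (i + 1) + 1 - k +
      (Finset.univ.filter fun a : Fin n =>
        (a.val < k ∧ (w a).val < i) ∧ (q - n).toNat ≤ (u a).val).card := by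
  rw [lowCount_eq (hc.fuw_mem_bound hk) (by omega)]
  congr 2
  symm
  refine Finset.card_bij (fun b _ => ((w b).val : ℤ) + 1) ?_ ?_ ?_
  · intro b hb
    simp only [Finset.mem_filter, Finset.mem_univ, true_and, Finset.mem_Ioc] at hb ⊢
    have := Fin.le_def.1 (hc.le b hb.1.1)
    rw [fuw_apply_zero]
    simp only [omega, hb.1.1, if_true]
    omega
  · intro b _ b' _ h
    apply w.injective
    ext
    omega
  · intro p hp
    simp only [Finset.mem_filter, Finset.mem_Ioc] at hp
    obtain ⟨m, b, rfl⟩ := exists_eq_window w p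
    rw [fuw_apply] at hp
    have h1 := (w b).isLt
    have h2 := (u b).isLt
    have hn : (0 : ℤ) < n := by omega
    have hm1 : (-1) * (n : ℤ) < m * n := by omega
    have hm2 : m * (n : ℤ) < 1 * n := by omega
    have hm1' := lt_of_mul_lt_mul_right hm1 hn.le
    have hm2' := lt_of_mul_lt_mul_right hm2 hn.le
    obtain rfl : m = 0 := by omega
    rcases omega_cases k b with ⟨h3, h4⟩ | ⟨h3, h4⟩ <;> rw [h4] at hp
    · refine ⟨b, ?_, by ring⟩
      simp only [Finset.mem_filter, Finset.mem_univ, true_and]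
      exact ⟨⟨h3, by omega⟩, by omega⟩
    · omega

theorem card_filter_apply (w : Equiv.Perm (Fin n)) (P : Fin n → Prop) [DecidablePred P] :
    (Finset.univ.filter fun a => P (w a)).card = (Finset.univ.filter P).card := by
  rw [Finset.card_filter, Finset.card_filter]
  exact Equiv.sum_comp w (fun a => if P a then 1 else 0)

theorem card_split_position (P : Fin n → Prop) [DecidablePred P] (c : ℕ) :
    (Finset.univ.filter fun a : Fin n => a.val < c ∧ P a).card +
      (Finset.univ.filter fun a : Fin n => c ≤ a.val ∧ P a).card = (Finset.univ.filter P).card := by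
  have h := Finset.card_filter_add_card_filter_not (s := Finset.univ.filter P)
    (fun a : Fin n => a.val < c)
  simp only [Finset.filter_filter, not_lt] at h
  simp only [and_comm (b := P _)]
  exact h

/-- This and the next lemma are what the Grassmannian condition is for: the position sets in the
rank formulas become a final or an initial segment, so the ranks of $f$ become ranks of $u$ alone.
-/
theorem Grassmannian.exists_upper {k : ℕ} {w : Equiv.Perm (Fin n)} (hw : Grassmannian k w)
    (i : ℕ) : ∃ c : ℕ, ∀ b : Fin n, (¬ b.val < k ∧ i ≤ (w b).val) ↔ c ≤ b.val := by
  classical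
  have hex : ∃ c : ℕ, ∀ b : Fin n, c ≤ b.val → (¬ b.val < k ∧ i ≤ (w b).val) :=
    ⟨n, fun b hb => absurd b.isLt (not_lt.2 hb)⟩
  refine ⟨Nat.find hex, fun b => ⟨fun hb => Nat.find_min' hex fun b' hb' => ?_,
    fun hb => Nat.find_spec hex b hb⟩⟩
  rcases hb'.eq_or_lt with he | hlt
  · rw [← Fin.ext he]; exact hb
  · have h1 : SameBlock k b b' := by unfold SameBlock; omega
    have := Fin.lt_def.1 (hw b b' (Fin.lt_def.2 hlt) h1)
    omega

theorem Grassmannian.exists_lower {k : ℕ} {w : Equiv.Perm (Fin n)} (hw : Grassmannian k w)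
    (i : ℕ) : ∃ c : ℕ, ∀ a : Fin n, (a.val < k ∧ (w a).val < i) ↔ a.val < c := by
  classical
  have hex : ∃ c : ℕ, ∀ a : Fin n, (a.val < k ∧ (w a).val < i) → a.val < c :=
    ⟨n, fun a _ => a.isLt⟩
  refine ⟨Nat.find hex, fun a => ⟨fun ha => Nat.find_spec hex a ha, fun ha => ?_⟩⟩
  by_contra hc
  refine absurd ha (not_lt.2 (Nat.find_min' hex fun b hb => ?_))
  by_contra hlt
  rcases (not_lt.1 hlt).eq_or_lt with he | hlt
  · rw [Fin.ext he] at hc; exact hc hb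
  · have h1 : SameBlock k a b := by unfold SameBlock; omega
    have := Fin.lt_def.1 (hw a b (Fin.lt_def.2 hlt) h1)
    omega

/-- Nested intervals have comparable rank numbers. -/
theorem Grassmannian.lowCount_le {k : ℕ} (hk : k ≤ n) {u w u' w' : Equiv.Perm (Fin n)}
    (hc : KCriterion k u w) (hw : Grassmannian k w) (hc' : KCriterion k u' w')
    (hu : RankLE u u') (hww : RankLE w' w) (r q : ℤ) :
    lowCount (fuw k u w) r q ≤ lowCount (fuw k u' w') r q := by
  obtain ⟨m, a, rfl⟩ := exists_eq_window (1 : Equiv.Perm (Fin n)) r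
  rw [Equiv.Perm.one_apply]
  obtain ⟨q, rfl⟩ : ∃ q', q = q' + m * n := ⟨q - m * n, by ring⟩
  rw [show m * n + (a.val : ℤ) + 1 = (a.val + 1) + m * n by ring, lowCount_add_mul,
    lowCount_add_mul]
  rcases le_or_gt q n with hq | hq
  · rw [lowCount_fuw_of_le hq hc, lowCount_fuw_of_le hq hc']
    set j := q.toNat
    obtain ⟨c, hcb⟩ := hw.exists_upper a.val
    simp only [hcb]
    -- On this final segment every value of $w$ is at least $a$. Since $w'$ has no more such values
    -- before $c$ and equally many in total, it fills the segment too.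
    have hw' : ∀ b : Fin n, c ≤ b.val → a.val ≤ (w' b).val := by
      have h1 := card_split_position (fun b => a.val ≤ (w b).val) c
      have h2 := card_split_position (fun b => a.val ≤ (w' b).val) c
      rw [card_filter_apply w (fun b => a.val ≤ b.val)] at h1
      rw [card_filter_apply w' (fun b => a.val ≤ b.val)] at h2
      have h3 := hww c a.val
      unfold permRank at h3
      have h4 : (Finset.univ.filter fun b : Fin n => c ≤ b.val ∧ a.val ≤ (w b).val) =
          Finset.univ.filter fun b : Fin n => c ≤ b.val :=
        Finset.filter_congr fun b _ => ⟨fun h => h.1, fun h => ⟨h, ((hcb b).2 h).2⟩⟩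
      rw [h4] at h1
      have h5 : (Finset.univ.filter fun b : Fin n => c ≤ b.val ∧ a.val ≤ (w' b).val) =
          Finset.univ.filter fun b : Fin n => c ≤ b.val :=
        Finset.eq_of_subset_of_card_le (Finset.monotone_filter_right _ fun b _ h => h.1) (by omega)
      intro b hb
      have : b ∈ Finset.univ.filter fun b : Fin n => c ≤ b.val := by simpa using hb
      rw [← h5] at this
      simp only [Finset.mem_filter, Finset.mem_univ, true_and] at this
      exact this.2
    have hcount : (Finset.univ.filter fun b : Fin n => c ≤ b.val ∧ (u b).val < j).card ≤
        (Finset.univ.filter fun b : Fin n => c ≤ b.val ∧ (u' b).val < j).card := by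
      have h1 := card_split_position (fun b => j ≤ (u b).val) c
      have h2 := card_split_position (fun b => j ≤ (u' b).val) c
      rw [card_filter_apply u (fun b => j ≤ b.val)] at h1
      rw [card_filter_apply u' (fun b => j ≤ b.val)] at h2
      have h3 := hu c j
      unfold permRank at h3
      have h4 := Finset.card_filter_add_card_filter_not
        (s := Finset.univ.filter fun b : Fin n => c ≤ b.val) (fun b => j ≤ (u b).val)
      have h5 := Finset.card_filter_add_card_filter_not
        (s := Finset.univ.filter fun b : Fin n => c ≤ b.val) (fun b => j ≤ (u' b).val)
      simp only [Finset.filter_filter, not_le] at h4 h5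
      omega
    refine hcount.trans (Finset.card_le_card (Finset.monotone_filter_right _ fun b _ h => ?_))
    exact ⟨⟨((hcb b).2 h.1).1, hw' b h.1⟩, h.2⟩
  · have h1 := lowCount_fuw_of_lt hk a.isLt hq hc
    have h2 := lowCount_fuw_of_lt hk a.isLt hq hc'
    obtain ⟨c, hca⟩ := hw.exists_lower a.val
    have h3 := hu c (q - n).toNat
    have h4 : permRank u' c (q - n).toNat ≤ (Finset.univ.filter fun x : Fin n =>
        (x.val < k ∧ (w' x).val < a.val) ∧ (q - n).toNat ≤ (u' x).val).card := by
      refine Finset.card_le_card (Finset.monotone_filter_right _ fun x _ h => ?_)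
      refine ⟨⟨((hca x).2 h.1).1, ?_⟩, h.2⟩
      have h5 := hww c a.val
      -- On this initial segment $w$ stays below $a$, hence so does $w'$, which has smaller ranks.
      have h6 : permRank w c a.val = 0 := by
        rw [permRank, Finset.card_eq_zero, Finset.filter_eq_empty_iff]
        rintro y - ⟨h7, h8⟩
        have := ((hca y).2 h7).2
        omega
      rw [h6, Nat.le_zero, permRank, Finset.card_eq_zero, Finset.filter_eq_empty_iff] at h5
      by_contra hcon
      exact h5 (Finset.mem_univ x) ⟨h.1, not_lt.1 hcon⟩
    simp only [hca] at h1
    unfold permRank at h3 h4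
    omega

end FiniteRank

/-! ### The isomorphism -/

section Iso

variable {k n : ℕ} [NeZero n]

/-- The map `⟨u,w⟩ ↦ f_{u,w}`. -/
noncomputable def toBound (hk : k ≤ n) : Q k n → Bound k n :=
  Quot.lift (fun I => ⟨fuw k I.u I.w, I.le.kCriterion.fuw_mem_bound hk⟩) (by
    rintro I J ⟨z, hz, ⟨hu, -⟩, ⟨hw, -⟩⟩
    apply Subtype.ext
    simp only [hu, hw]
    exact (fuw_mul_right k _ _ z hz).symm)

theorem toBound_injective (hk : k ≤ n) : Function.Injective (toBound (k := k) (n := n) hk) := by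
  intro x y hxy
  induction x using Quot.inductionOn with | _ I
  induction y using Quot.inductionOn with | _ J
  have h : fuw k I.u I.w = fuw k J.u J.w := congrArg Subtype.val hxy
  obtain ⟨u₀, w₀, h₀, hg₀, hcls, hfuw, -⟩ := I.le.kCriterion.exists_grassmannian hk
  obtain ⟨u₁, w₁, h₁, hg₁, hcls', hfuw', -⟩ := J.le.kCriterion.exists_grassmannian hk
  obtain ⟨rfl, rfl⟩ := eq_of_fuw_eq (by rw [hfuw, h, hfuw']) hg₀ hg₁
  exact hcls.trans hcls'.symm

theorem toBound_surjective (hk : k ≤ n) : Function.Surjective (toBound (k := k) (n := n) hk) := by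
  intro f
  obtain ⟨u, w, hc, -, hf⟩ := exists_fuw_eq hk f.2
  exact ⟨(⟨u, w, hc.kBruhatLE hk⟩ : KInterval k n).cls, Subtype.ext hf⟩

theorem KCriterion.bruhatLE (hk : k ≤ n) {u w : Equiv.Perm (Fin n)} (h : KCriterion k u w) :
    BruhatLE u w := by
  have := h.kBruhatLE hk
  induction this with
  | refl => exact Relation.ReflTransGen.refl
  | tail h1 hs ih => exact (ih (KBruhatLE.kCriterion h1)).trans hs.1.1

/-- Rank numbers mediate in both directions. From the Bruhat order they yield nested
representatives, starting from any representative of the lower class. From nesting, the Grassmannian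
representative of the outer interval gives the rank inequality, and this gives a Bruhat chain. -/
theorem boundLE_toBound_iff (hk : k ≤ n) (x y : Q k n) :
    BoundLE k n (toBound hk x) (toBound hk y) ↔ QLE k n x y := by
  constructor
  · intro h
    induction x using Quot.inductionOn with | _ I
    have hI := I.le.kCriterion
    obtain ⟨-, u', w', hc, hf, hu, hw⟩ := hI.exists_of_lowCount_le hk (toBound hk y).2
      (AffineBruhatLE.lowCount_le h (toBound hk y).2.2)
    refine ⟨I, ⟨u', w', hc.kBruhatLE hk⟩, rfl, toBound_injective hk (Subtype.ext hf), ?_⟩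
    exact fun v hv => ⟨hu.trans hv.1, hv.2.trans hw⟩
  · rintro ⟨I, J, rfl, rfl, hsub⟩
    have hI := I.le.kCriterion
    have hJ := J.le.kCriterion
    have hle := hJ.bruhatLE hk
    have hu := (hsub ⟨Relation.ReflTransGen.refl, hle⟩).1
    have hw := (hsub ⟨hle, Relation.ReflTransGen.refl⟩).2
    obtain ⟨u₀, w₀, h₀, hg₀, -, hfuw, hmove⟩ := hI.exists_grassmannian hk
    obtain ⟨u₁, w₁, h₁, hfuw', hu₁, hw₁⟩ :=
      hmove J.u J.w hJ (BruhatLE.rankLE hu) (BruhatLE.rankLE hw)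
    have key := hI.exists_of_lowCount_le hk (hJ.fuw_mem_bound hk) (by
      rw [← hfuw, ← hfuw']
      exact hg₀.lowCount_le hk h₀ h₁ hu₁ hw₁)
    exact key.1

instance isPartialOrder_boundLE : IsPartialOrder (Bound k n) (BoundLE k n) where
  refl _ := Relation.ReflTransGen.refl
  trans _ _ _ h1 h2 := Relation.ReflTransGen.trans h1 h2
  antisymm f g h1 h2 := by
    rcases AffineBruhatLE.eq_or_affineLength_lt h1 with h | h
    · exact Subtype.ext h
    · rcases AffineBruhatLE.eq_or_affineLength_lt h2 with h' | h'
      · exact Subtype.ext h'.symm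
      · omega

/-- The isomorphism `Q(k,n) ≃ Bound(k,n)`. -/
noncomputable def isoBound (hk : k ≤ n) : QLE k n ≃r BoundLE k n where
  toEquiv := Equiv.ofBijective (toBound hk) ⟨toBound_injective hk, toBound_surjective hk⟩
  map_rel_iff' := fun {x y} => boundLE_toBound_iff hk x y

end Iso

end BoundedAffine

theorem theorem3 (k n : ℕ) [NeZero n] (hk : k ≤ n) :
    -- both relations are partial orders
    IsPartialOrder (BoundedAffine.Q k n) (BoundedAffine.QLE k n) ∧
    IsPartialOrder (BoundedAffine.Bound k n) (BoundedAffine.BoundLE k n) ∧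
    -- the map is well defined, bijective, and preserves and reflects the order
    (∃ Φ : BoundedAffine.QLE k n ≃r BoundedAffine.BoundLE k n,
      ∀ I : BoundedAffine.KInterval k n,
        (Φ I.cls : BoundedAffine.AffinePerm n) = BoundedAffine.fuw k I.u I.w) ∧
    -- the length formula
    (∀ I : BoundedAffine.KInterval k n,
      (BoundedAffine.affineLength (BoundedAffine.fuw k I.u I.w) : ℤ) =
        (k : ℤ) * ((n : ℤ) - (k : ℤ)) - (BoundedAffine.permLength I.w : ℤ)
          + (BoundedAffine.permLength I.u : ℤ)) ∧
    -- the bounded affine permutations form a lower order ideal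
    (∀ f ∈ BoundedAffine.Bound k n, ∀ g ∈ BoundedAffine.AffinePermOfBall k n,
      BoundedAffine.AffineBruhatLE g f → g ∈ BoundedAffine.Bound k n) := by
  -- Transitivity and antisymmetry of `QLE` are not visible from its definition, since
  -- representatives vary; they are pulled back along the isomorphism.
  refine ⟨(BoundedAffine.isoBound hk).toRelEmbedding.isPartialOrder,
    BoundedAffine.isPartialOrder_boundLE, ⟨BoundedAffine.isoBound hk, fun I => rfl⟩, fun I => ?_,
    fun f hf g hg hle => ⟨hg, hle.bounded hf.2⟩⟩
  have h := BoundedAffine.affineLength_fuw hk I.u I.w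
  rw [(BoundedAffine.KBruhatLE.kCriterion I.le).blockDefect] at h
  push_cast at h
  linarith
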